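/- Let $\mathcal A$ be an alphabet with $d\ge 2$ letters, let $\pi_0,\pi_1:\mathcal A\to\{1,\dots,d\}$ be bijections and $\lambda\in(0,\infty)^{\mathcal A}$, $|\lambda|=\sum_\alpha\lambda_\alpha$. Put $\ell_\alpha=\sum_{\pi_0(\beta)<\pi_0(\alpha)}\lambda_\beta$ and $\ell'_\alpha=\sum_{\pi_1(\beta)<\pi_1(\alpha)}\lambda_\beta$, and let $T:[0,|\lambda|)\to[0,|\lambda|)$ be the interval exchange transformation that translates $[\ell_\alpha,\ell_\alpha+\lambda_\alpha)$ to $[\ell'_\alpha,\ell'_\alpha+\lambda_\alpha)$ for every $\alpha$. Assume that $T$ is irreducible, that is, $\pi_0^{-1}(\{1,\dots,j\})\ne\pi_1^{-1}(\{1,\dots,j\})$ for $1\le j<d$, and that $T$ satisfies the Keane condition: the $T$-orbits of the points $\ell_\alpha$ with $\pi_0(\alpha)\ne1$ are infinite and pairwise disjoint. Rauzy induction. For an irreducible $T$ satisfying the Keane condition, with data $(\pi,\lambda)$, let $\varepsilon=0$ if $\lambda_{\pi_0^{-1}(d)}>\lambda_{\pi_1^{-1}(d)}$ and $\varepsilon=1$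 if $\lambda_{\pi_0^{-1}(d)}<\lambda_{\pi_1^{-1}(d)}$. The letter $w=\pi_\varepsilon^{-1}(d)$ is the winner of this step, $v=\pi_{1-\varepsilon}^{-1}(d)$ is the loser, and $\Theta(T)=I+E_{w,v}$, where $E_{w,v}$ has a single nonzero entry, equal to $1$, at position $(w,v)$. The transformation $\mathcal R(T)$ is the one with length data $\Theta(T)^{-1}\lambda$ (so $\lambda_w$ is replaced by $\lambda_w-\lambda_v$) and combinatorial data $(\tilde\pi_0,\tilde\pi_1)$, where $\tilde\pi_\varepsilon=\pi_\varepsilon$ and $\tilde\pi_{1-\varepsilon}$ is obtained from $\pi_{1-\varepsilon}$ by moving the last letter $v$ to the place immediately after $w$: $\tilde\pi_{1-\varepsilon}(\alpha)$ is $\pi_{1-\varepsilon}(\alpha)$ if $\pi_{1-\varepsilon}(\alpha)\le\pi_{1-\varepsilon}(w)$, it is $\pi_{1-\varepsilon}(\alpha)+1$ if $\pi_{1-\varepsilon}(w)<\pi_{1-\varepsilon}(\alpha)<d$, and it is $\pi_{1-\varepsilon}(w)+1$ if $\pi_{1-\varepsilon}(\alpha)=d$. It is again irreducible with the Keane condition.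 For $n<n'$ let $B(n,n')=\Theta(\mathcal R^{n}T)\,\Theta(\mathcal R^{n+1}T)\cdots\Theta(\mathcal R^{n'-1}T)$. Let $m_0=0$ and let $m_{k+1}$ be the largest integer such that at most $d-1$ different letters are winners of the induction steps from $\mathcal R^{n-1}T$ to $\mathcal R^{n}T$ with $m_k<n\le m_{k+1}$. The transformation $T$ is of bounded type if its Marmi-Moussa-Yoccoz cocycle is bounded: there is $C>0$ such that all entries of $B(m_k,m_{k+1})$ have absolute value at most $C$, for all $k\ge 0$. Partitions. A finite set $S\subset[0,|\lambda|)$ determines the partition $\mathcal P(S)$ of $[0,|\lambda|)$ into the intervals $[x,y)$ with $x<y$ consecutive points of $S\cup\{0,|\lambda|\}$; $\min\mathcal P(S)$ and $\max\mathcal P(S)$ are the smallest and the largest length of its atoms. Let $\mathcal P^\alpha_{n,j}=\mathcal P(\{T^{-k+j}\ell_\alpha:0\le k\le n-1\})$ and $\mathcal P_{n,j}=\mathcal P(\{T^{-k+j}\ell_\alpha:\alpha\in\mathcal A,\ 0\le k\le n-1\})$. The transformation $T$ has balanced partition lengths if there is $c>0$ such that for all $n\ge1$ and all $0\le j\le n-1$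 $$\frac1{cn}<\min\mathcal P^\alpha_{n,j}\le\max\mathcal P^\alpha_{n,j}<\frac cn\ \text{ for every }\alpha\in\mathcal A,\qquad \frac1{cn}<\min\mathcal P_{n,j}\le\max\mathcal P_{n,j}<\frac cn .$$ Then $T$ is of bounded type if and only if $T$ has balanced partition lengths. -/

import Mathlib

/-- Data `(π, λ)` of an interval exchange transformation of `d ≥ 1` intervals labelled by the
alphabet `A`. The two bijections `π₀ = perm false` and `π₁ = perm true` give the positions of the
letters before and after the exchange (positions are counted `0, …, d - 1`, so the position `p`
here is the position `p + 1` in one-based counting), and `len` is the vector of lengths. -/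
structure IET (A : Type*) (d : ℕ) where
  perm : Bool → A ≃ Fin d
  len : A → ℝ
  one_le : 1 ≤ d
  len_pos : ∀ a, 0 < len a

namespace IET

noncomputable section

variable {A : Type*} [Fintype A] {d : ℕ}

/-- The total length `|λ|`. -/
def total (T : IET A d) : ℝ := ∑ a, T.len a

/-- The sum of the lengths of the letters at the first `p` positions of row `ε`. -/
def cut (T : IET A d) (ε : Bool) (p : ℕ) : ℝ :=
  ∑ b with (T.perm ε b : ℕ) < p, T.len b

/-- The left endpoint of the interval with label `a` in row `ε`: `ℓ_a` for `ε = false`,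
`ℓ'_a` for `ε = true`. -/
def left (T : IET A d) (ε : Bool) (a : A) : ℝ := T.cut ε (T.perm ε a)

theorem cut_zero (T : IET A d) (ε : Bool) : T.cut ε 0 = 0 := by
  simp [cut]

theorem cut_top (T : IET A d) (ε : Bool) : T.cut ε d = T.total := by
  simp [cut, total]

theorem cut_mono (T : IET A d) (ε : Bool) : Monotone (T.cut ε) := by
  intro p q h
  refine Finset.sum_le_sum_of_subset_of_nonneg ?_ fun b _ _ => (T.len_pos b).le
  intro b hb
  simp only [Finset.mem_filter, Finset.mem_univ, true_and] at hb ⊢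
  omega

theorem cut_succ (T : IET A d) (ε : Bool) (a : A) :
    T.cut ε ((T.perm ε a : ℕ) + 1) = T.left ε a + T.len a := by
  classical
  have h : (Finset.univ.filter fun b => (T.perm ε b : ℕ) < (T.perm ε a : ℕ) + 1) =
      insert a (Finset.univ.filter fun b => (T.perm ε b : ℕ) < (T.perm ε a : ℕ)) := by
    ext b
    simp only [Finset.mem_filter, Finset.mem_univ, true_and, Finset.mem_insert]
    rw [Nat.lt_succ_iff_lt_or_eq, ← Fin.ext_iff, (T.perm ε).injective.eq_iff]
    exact or_comm
  rw [cut, h, Finset.sum_insert (by simp), left, cut, add_comm]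

theorem left_nonneg (T : IET A d) (ε : Bool) (a : A) : 0 ≤ T.left ε a := by
  rw [← T.cut_zero ε]
  exact T.cut_mono ε (Nat.zero_le _)

theorem left_add_len_le (T : IET A d) (ε : Bool) (a : A) :
    T.left ε a + T.len a ≤ T.total := by
  rw [← T.cut_succ ε a, ← T.cut_top ε]
  exact T.cut_mono ε (T.perm ε a).isLt

theorem left_lt_total (T : IET A d) (ε : Bool) (a : A) : T.left ε a < T.total := by
  have h1 := T.left_add_len_le ε a
  have h2 := T.len_pos a
  linarith

/-- The point `ℓ_a + t` (or `ℓ'_a + t`) of `[0, |λ|)`, for `0 ≤ t < λ_a`. -/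
def place (T : IET A d) (ε : Bool) (x : Σ a, Set.Ico (0 : ℝ) (T.len a)) :
    Set.Ico (0 : ℝ) T.total :=
  ⟨T.left ε x.1 + x.2.1, add_nonneg (T.left_nonneg ε x.1) x.2.2.1,
    lt_of_lt_of_le (add_lt_add_right x.2.2.2 _) (T.left_add_len_le ε x.1)⟩

theorem place_bijective (T : IET A d) (ε : Bool) : Function.Bijective (T.place ε) := by
  constructor
  · have key : ∀ x y : Σ a, Set.Ico (0 : ℝ) (T.len a),
        (T.perm ε x.1 : ℕ) < (T.perm ε y.1 : ℕ) → T.place ε x ≠ T.place ε y := by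
      intro x y hlt h
      have h1 : T.left ε x.1 + x.2.1 = T.left ε y.1 + y.2.1 := congrArg Subtype.val h
      have h2 : T.left ε x.1 + T.len x.1 ≤ T.left ε y.1 := by
        rw [← T.cut_succ ε x.1]
        exact T.cut_mono ε hlt
      have h3 := x.2.2.2
      have h4 := y.2.2.1
      linarith
    intro x y h
    rcases lt_trichotomy (T.perm ε x.1 : ℕ) (T.perm ε y.1 : ℕ) with hlt | heq | hgt
    · exact absurd h (key x y hlt)
    · obtain ⟨a, t⟩ := x
      obtain ⟨b, s⟩ := y
      obtain rfl : a = b := (T.perm ε).injective (Fin.ext heq)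
      have h1 : T.left ε a + t.1 = T.left ε a + s.1 := congrArg Subtype.val h
      have h2 : t = s := Subtype.ext (add_left_cancel h1)
      rw [h2]
    · exact absurd h.symm (key y x hgt)
  · rintro ⟨x, hx0, hx1⟩
    have hex : ∃ p, x < T.cut ε p := ⟨d, by rwa [T.cut_top ε]⟩
    classical
    have hp := Nat.find_spec hex
    have hmin := fun q (hq : q < Nat.find hex) => Nat.find_min hex hq
    have hd : Nat.find hex ≤ d := Nat.find_min' hex (by rwa [T.cut_top ε])
    have hp0 : Nat.find hex ≠ 0 := by
      intro h0
      rw [h0, T.cut_zero ε] at hp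
      linarith
    obtain ⟨q, hq⟩ := Nat.exists_eq_succ_of_ne_zero hp0
    have hqd : q < d := by omega
    have ha : (T.perm ε ((T.perm ε).symm ⟨q, hqd⟩) : ℕ) = q := by simp
    have hl : T.left ε ((T.perm ε).symm ⟨q, hqd⟩) ≤ x := by
      rw [left, ha]
      exact not_lt.mp (hmin q (by omega))
    have hr : x < T.left ε ((T.perm ε).symm ⟨q, hqd⟩) +
        T.len ((T.perm ε).symm ⟨q, hqd⟩) := by
      rw [← T.cut_succ ε, ha]
      rwa [hq] at hp
    refine ⟨⟨(T.perm ε).symm ⟨q, hqd⟩,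
      ⟨x - T.left ε ((T.perm ε).symm ⟨q, hqd⟩), ?_, ?_⟩⟩, ?_⟩
    · linarith
    · linarith
    · apply Subtype.ext
      simp [place]

/-- The decomposition of `[0, |λ|)` into the intervals of row `ε`. -/
def placeEquiv (T : IET A d) (ε : Bool) :
    (Σ a, Set.Ico (0 : ℝ) (T.len a)) ≃ Set.Ico (0 : ℝ) T.total :=
  Equiv.ofBijective (T.place ε) (T.place_bijective ε)

/-- The interval exchange transformation `T : [0, |λ|) → [0, |λ|)` as a bijection:
`ℓ_a + t ↦ ℓ'_a + t` for `0 ≤ t < λ_a`. -/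
def map (T : IET A d) : Equiv.Perm (Set.Ico (0 : ℝ) T.total) :=
  (T.placeEquiv false).symm.trans (T.placeEquiv true)

/-- `T` translates `I_a` to `I'_a`. -/
theorem map_apply (T : IET A d) (a : A) (x : Set.Ico (0 : ℝ) T.total)
    (h1 : T.left false a ≤ x) (h2 : (x : ℝ) < T.left false a + T.len a) :
    (T.map x : ℝ) = x - T.left false a + T.left true a := by
  have hx : x = T.placeEquiv false ⟨a, ⟨x - T.left false a, by linarith, by linarith⟩⟩ := by
    apply Subtype.ext
    simp [placeEquiv, place]
  conv_lhs => rw [hx]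
  simp only [map, Equiv.trans_apply, Equiv.symm_apply_apply]
  simp [placeEquiv, place, add_comm]

/-- The left endpoint `ℓ_a` as a point of `[0, |λ|)`. -/
def leftPt (T : IET A d) (a : A) : Set.Ico (0 : ℝ) T.total :=
  ⟨T.left false a, T.left_nonneg false a, T.left_lt_total false a⟩

/-- Irreducibility (admissibility) of the combinatorial data. -/
def IsIrreducible (T : IET A d) : Prop :=
  ∀ j : ℕ, 1 ≤ j → j < d →
    {a | (T.perm false a : ℕ) < j} ≠ {a | (T.perm true a : ℕ) < j}

/-- The two-sided orbit of a point. -/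
def orbit (T : IET A d) (x : Set.Ico (0 : ℝ) T.total) : Set (Set.Ico (0 : ℝ) T.total) :=
  Set.range fun i : ℤ => (T.map ^ i) x

/-- The Keane condition: the orbits of the `ℓ_a` for `a` not in the first position are infinite
and pairwise disjoint. -/
def Keane (T : IET A d) : Prop :=
  (∀ a, (T.perm false a : ℕ) ≠ 0 → (T.orbit (T.leftPt a)).Infinite) ∧
  ∀ a b, (T.perm false a : ℕ) ≠ 0 → (T.perm false b : ℕ) ≠ 0 → a ≠ b →
    Disjoint (T.orbit (T.leftPt a)) (T.orbit (T.leftPt b))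

/-- The letter in the last position of row `ε`. -/
def last (T : IET A d) (ε : Bool) : A :=
  (T.perm ε).symm ⟨d - 1, Nat.sub_lt T.one_le Nat.one_pos⟩

/-- The type `ε(π, λ)`: `false` (i.e. `0`) if the last interval of the top row is longer than the
last interval of the bottom row, `true` (i.e. `1`) if it is shorter. The two lengths are never equal
when the Keane condition holds and `d ≥ 2`. -/
def type (T : IET A d) : Bool :=
  if T.len (T.last true) < T.len (T.last false) then false else true

/-- The winner, i.e. the letter of the longer of the two last intervals. It is the name taken by the
corresponding arrow of the Rauzy diagram. -/
def winner (T : IET A d) : A := T.last T.type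

/-- The letter of the shorter of the two last intervals. -/
def loser (T : IET A d) : A := T.last (!T.type)

/-- The change of positions in the row of the loser, if the winner has position `w` there: positions
up to `w` are kept, those strictly between `w` and the last one move right by one, and the last
letter is inserted just after `w`. -/
def shift (w p : Fin d) : Fin d :=
  if h₁ : (p : ℕ) ≤ w then p
  else if h₂ : (p : ℕ) < d - 1 then ⟨p + 1, by omega⟩
  else ⟨w + 1, by omega⟩

theorem shift_bijective (w : Fin d) : Function.Bijective (shift w) := by
  rw [← Finite.injective_iff_bijective]
  intro p q h
  have hp := p.isLt
  have hq := q.isLt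
  unfold shift at h
  apply Fin.ext
  split_ifs at h <;> simp only [Fin.ext_iff] at h <;> omega

/-- One step of Rauzy–Veech induction: `R_ε` is applied to the combinatorial data, and the length of
the loser is subtracted from that of the winner. (If the two lengths coincide, the induction is not
defined and the lengths are left unchanged here; this does not occur under the Keane
condition when `d ≥ 2`.) -/
def rauzy [DecidableEq A] (T : IET A d) : IET A d where
  perm := fun ε =>
    if ε = T.type then T.perm ε
    else (T.perm ε).trans (Equiv.ofBijective _ (shift_bijective (T.perm ε T.winner)))
  len := fun a =>
    if a = T.winner ∧ T.len T.loser < T.len T.winner then T.len T.winner - T.len T.loser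
    else T.len a
  one_le := T.one_le
  len_pos := by
    intro a
    split_ifs with h
    · exact sub_pos.mpr h.2
    · exact T.len_pos a

/-- The matrix `Θ(T) = I + E_{winner, loser}`. -/
def theta [DecidableEq A] (T : IET A d) : Matrix A A ℤ :=
  1 + Matrix.single T.winner T.loser 1

/-- `B(n, n') = Θ(Rⁿ T) ⬝ Θ(Rⁿ⁺¹ T) ⬝ … ⬝ Θ(Rⁿ'⁻¹ T)`, the product being taken in this order. -/
def cocycle [DecidableEq A] (T : IET A d) (n n' : ℕ) : Matrix A A ℤ :=
  ((List.range' n (n' - n)).map fun i => theta (rauzy^[i] T)).prod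

/-- The set of names taken by the arrows number `n + 1, …, n'` of the Rauzy path of `T`, where the
arrow number `i + 1` is the induction step from `Rⁱ T` to `Rⁱ⁺¹ T`. -/
def names [DecidableEq A] (T : IET A d) (n n' : ℕ) : Finset A :=
  (Finset.Ico n n').image fun i => winner (rauzy^[i] T)

/-- `m` is the sequence of times with `m 0 = 0` for which `m (k + 1)` is the largest integer such
that no more than `D` names are taken between `m k` and `m (k + 1)`. -/
def IsAcceleration [DecidableEq A] (T : IET A d) (D : ℕ) (m : ℕ → ℕ) : Prop :=
  m 0 = 0 ∧ ∀ k, IsGreatest {n | m k ≤ n ∧ (T.names (m k) n).card ≤ D} (m (k + 1))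

/-- Bounded type: the Marmi–Moussa–Yoccoz cocycle `B(m_k, m_{k+1})`, which belongs to the
acceleration with `D = d - 1` names, is bounded for the maximum norm of matrices. -/
def IsBoundedType [DecidableEq A] (T : IET A d) : Prop :=
  ∃ m : ℕ → ℕ, T.IsAcceleration (d - 1) m ∧
    ∃ C : ℝ, 0 < C ∧ ∀ k a b, |(T.cocycle (m k) (m (k + 1)) a b : ℝ)| ≤ C

/-- The partition of `[0, L)` into intervals determined by a finite set `S` of points of `[0, L)`. An
atom `[x, y)` is encoded by its endpoints `(x, y)`, which are consecutive points of
`S ∪ {0, L}`. -/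
def atoms (L : ℝ) (S : Set ℝ) : Set (ℝ × ℝ) :=
  {p | p.1 ∈ S ∪ {0, L} ∧ p.2 ∈ S ∪ {0, L} ∧ p.1 < p.2 ∧
    ∀ z ∈ S ∪ {0, L}, ¬ (p.1 < z ∧ z < p.2)}

/-- The smallest length of an atom. -/
def minLength (P : Set (ℝ × ℝ)) : ℝ := sInf ((fun p => p.2 - p.1) '' P)

/-- The largest length of an atom. -/
def maxLength (P : Set (ℝ × ℝ)) : ℝ := sSup ((fun p => p.2 - p.1) '' P)

/-- The set `{T^{-k+j} ℓ_a : 0 ≤ k ≤ n - 1}`. -/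
def preimages (T : IET A d) (a : A) (n : ℕ) (j : ℤ) : Set ℝ :=
  {x | ∃ k : ℕ, k < n ∧ x = (T.map ^ (-(k : ℤ) + j)) (T.leftPt a)}

/-- The partition determined by `n` consecutive preimages of the single discontinuity `ℓ_a`. -/
def partitionOne (T : IET A d) (a : A) (n : ℕ) (j : ℤ) : Set (ℝ × ℝ) :=
  atoms T.total (T.preimages a n j)

/-- The partition determined by `n` consecutive preimages of all discontinuities `ℓ_a`. -/
def partitionAll (T : IET A d) (n : ℕ) (j : ℤ) : Set (ℝ × ℝ) :=
  atoms T.total (⋃ a, T.preimages a n j)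

/-- `1 / (c n) < min P ≤ max P < c / n`. -/
def IsBalanced (c : ℝ) (n : ℕ) (P : Set (ℝ × ℝ)) : Prop :=
  1 / (c * n) < minLength P ∧ minLength P ≤ maxLength P ∧ maxLength P < c / n

/-- Balanced partition lengths. -/
def HasBalancedPartitionLengths (T : IET A d) : Prop :=
  ∃ c : ℝ, 0 < c ∧ ∀ n j : ℕ, j < n →
    (∀ a, IsBalanced c n (T.partitionOne a n j)) ∧ IsBalanced c n (T.partitionAll n j)

end

end IET

/-!
Both conditions are compared with the geometry of the towers of Rauzy induction. At time `n` the
exchange `Rⁿ T` is the first return map of `T` to `[0, |Rⁿ T|)`; the interval with label `a`, of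
length `λ_a`, returns after `h_a` steps, so `[0, |λ|)` is the disjoint union of towers with base
`λ_a` and height `h_a`, and each `ℓ_a` is the left endpoint of a floor of the tower with label `a`
(`IsTower`, `isTower_height`). Between two times, lengths and heights are related by
`λ = B λ'` and `h' = h B` (`len_eq_sum`, `height_eq_sum`). The Keane condition enters in two ways:
it keeps the induction defined (`IsTower.len_last_ne`), and it makes the orbits of the `ℓ_a`
injective (`zpow_leftPt_injective`).

*Balanced lengths give bounded type.* A tower is a piece of the orbit of `ℓ_a` that meets the base
once, so the density of such pieces gives `h_a ≤ C / |Rⁿ T|`. The endpoints of the exchanged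
intervals are points of the orbits of the `ℓ_a` at times at most `max h`, so their separation gives
`h_a ≥ 1 / (C |Rⁿ T|)` and `λ_a ≥ |Rⁿ T| / C`. If the letter `e` does not win between `n` and `n'`,
its length does not change; hence `|Rⁿ T|` and `|Rⁿ' T|` are comparable, and
`B_{ab} ≤ h'_b / h_a` is bounded (`cocycle_le_of_balanced`). As the sum of the entries of `B` grows
with every step, this also shows that the times `m_k` exist.

*Bounded type gives balanced lengths.* All letters win between `m_k` and `m_{k+2}`, and a row of a
product of such matrices gains a positive entry every two such blocks (`card_reach_lt`). So along
the times `q_k = m_{4dk}` the cocycle has entries between `1` and some `M`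
(`IsBoundedPositive`), and at these times all lengths are comparable with each other, and so are all
heights. Let `σ_k` be the sum of the heights at time `q_k`; then `σ_{k+1} ≤ d M σ_k`.

* Separation: since `|R^{q_{k+1}} T|` is at most every length at time `q_k`, the floor of `ℓ_a`
  cannot stay near the bottom or the top of its tower (`IsTower.anchor_deep`). Hence the points
  `T^i ℓ_a` with `|i| ≤ σ_k` are left endpoints of floors at time `q_{k+2}`
  (`IsTower.zpow_mem_floorEnds`), and different ones are at least as far apart as the shortest of
  the lengths, which is of order `1 / σ_k`.
* Density: every tower at time `q_{k+1}` runs through all the towers at time `q_k`, so every orbit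
  segment of length `3 σ_{k+1}` meets every floor at time `q_k`, whose lengths are of order
  `1 / σ_k` (`IsBoundedPositive.exists_map_pow_eq`).
-/

namespace IET

noncomputable section

set_option linter.unusedSectionVars false

variable {A : Type*} [Fintype A] {d : ℕ}

/-! ### One step of Rauzy induction -/

theorem perm_last (T : IET A d) (ε : Bool) : (T.perm ε (T.last ε) : ℕ) = d - 1 := by
  simp [last]

theorem eq_last_of_perm (T : IET A d) {ε : Bool} {a : A} (h : (T.perm ε a : ℕ) = d - 1) :
    a = T.last ε :=
  (T.perm ε).injective (Fin.ext (h.trans (T.perm_last ε).symm))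

theorem left_last (T : IET A d) (ε : Bool) :
    T.left ε (T.last ε) + T.len (T.last ε) = T.total := by
  rw [← T.cut_succ, perm_last, Nat.sub_add_cancel T.one_le, cut_top]

theorem left_add_len_le_left (T : IET A d) (ε : Bool) {a b : A}
    (h : (T.perm ε a : ℕ) < T.perm ε b) : T.left ε a + T.len a ≤ T.left ε b := by
  rw [← T.cut_succ ε a]
  exact T.cut_mono ε h

theorem left_eq_zero (T : IET A d) {ε : Bool} {a : A} (h : (T.perm ε a : ℕ) = 0) :
    T.left ε a = 0 := by
  rw [left, h, cut_zero]

theorem exists_perm_eq_zero (T : IET A d) (ε : Bool) : ∃ a, (T.perm ε a : ℕ) = 0 :=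
  ⟨(T.perm ε).symm ⟨0, T.one_le⟩, by simp⟩

theorem total_pos (T : IET A d) : 0 < T.total := by
  obtain ⟨a, ha⟩ := T.exists_perm_eq_zero false
  have := T.left_lt_total false a
  rwa [T.left_eq_zero ha] at this

/-- The interval `[ℓ_a, ℓ_a + λ_a)` exchanged under the name `a`. -/
def cell (T : IET A d) (a : A) : Set ℝ := Set.Ico (T.left false a) (T.left false a + T.len a)

/-- The amount `ℓ'_a - ℓ_a` by which the interval with label `a` is translated. -/
def jump (T : IET A d) (a : A) : ℝ := T.left true a - T.left false a

theorem left_mem_cell (T : IET A d) (a : A) : T.left false a ∈ T.cell a :=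
  ⟨le_rfl, lt_add_of_pos_right _ (T.len_pos a)⟩

theorem lt_total_of_mem_cell (T : IET A d) {a : A} {x : ℝ} (h : x ∈ T.cell a) : x < T.total :=
  h.2.trans_le (T.left_add_len_le false a)

theorem exists_mem_cell (T : IET A d) {x : ℝ} (h0 : 0 ≤ x) (h1 : x < T.total) :
    ∃ a, x ∈ T.cell a := by
  obtain ⟨⟨a, t⟩, ht⟩ := (T.place_bijective false).2 ⟨x, h0, h1⟩
  have h : T.left false a + t = x := congrArg Subtype.val ht
  have h2 := t.2.1
  have h3 := t.2.2
  exact ⟨a, by rw [← h]; linarith, by rw [← h]; linarith⟩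

theorem IsIrreducible.last_ne {T : IET A d} (hT : T.IsIrreducible) (hd : 2 ≤ d) :
    T.last false ≠ T.last true := by
  intro h
  refine hT (d - 1) (by omega) (by omega) ?_
  have key : ∀ ε, {a | (T.perm ε a : ℕ) < d - 1} = {T.last ε}ᶜ := by
    intro ε
    ext a
    have := (T.perm ε a).isLt
    have h2 : (T.perm ε a : ℕ) = d - 1 ↔ a = T.last ε :=
      ⟨T.eq_last_of_perm, fun h => h ▸ T.perm_last ε⟩
    simp only [Set.mem_ofPred_eq, Set.mem_compl_iff, Set.mem_singleton_iff, ← h2]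
    omega
  rw [key, key, h]

section RauzyStep

variable [DecidableEq A]

theorem rauzy_perm_type (T : IET A d) : T.rauzy.perm T.type = T.perm T.type := by
  simp [rauzy]

theorem rauzy_perm_not_type (T : IET A d) (a : A) :
    T.rauzy.perm (!T.type) a = shift (T.perm (!T.type) T.winner) (T.perm (!T.type) a) := by
  simp [rauzy]

theorem rauzy_perm_eq_zero_iff (T : IET A d) (ε : Bool) (a : A) :
    (T.rauzy.perm ε a : ℕ) = 0 ↔ (T.perm ε a : ℕ) = 0 := by
  by_cases h : ε = T.type
  · rw [h, rauzy_perm_type]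
  · obtain rfl : ε = !T.type := by
      revert h; cases ε <;> cases T.type <;> simp
    rw [rauzy_perm_not_type, shift]
    split_ifs <;> simp <;> omega

/-- Rauzy induction preserves irreducibility. -/
theorem IsIrreducible.rauzy {T : IET A d} (hT : T.IsIrreducible) : T.rauzy.IsIrreducible := by
  intro j hj1 hjd h
  have h' : {a | (T.rauzy.perm T.type a : ℕ) < j} = {a | (T.rauzy.perm (!T.type) a : ℕ) < j} := by
    cases T.type
    · exact h
    · exact h.symm
  have hw : ¬ (T.rauzy.perm (!T.type) T.winner : ℕ) < j := by
    intro hlt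
    have hmem : T.winner ∈ {a | (T.rauzy.perm (!T.type) a : ℕ) < j} := hlt
    rw [← h', Set.mem_ofPred_eq, rauzy_perm_type, winner, perm_last] at hmem
    omega
  have hw' : j ≤ (T.perm (!T.type) T.winner : ℕ) := by
    rw [rauzy_perm_not_type, shift, dif_pos le_rfl] at hw
    omega
  -- The winner is last in its own row, so the two prefixes end before it, where nothing moves.
  have key : {a | (T.perm T.type a : ℕ) < j} = {a | (T.perm (!T.type) a : ℕ) < j} := by
    rw [rauzy_perm_type] at h'
    rw [h']
    ext a
    simp only [Set.mem_ofPred_eq, rauzy_perm_not_type, shift]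
    split_ifs <;> grind
  refine hT j hj1 hjd ?_
  revert key
  cases T.type
  · exact id
  · exact Eq.symm

theorem loser_ne_winner {T : IET A d} (h : T.len T.loser < T.len T.winner) :
    T.loser ≠ T.winner := fun h' => by rw [h'] at h; exact lt_irrefl _ h

theorem rauzy_len {T : IET A d} (h : T.len T.loser < T.len T.winner) (a : A) :
    T.rauzy.len a = T.len a - if a = T.winner then T.len T.loser else 0 := by
  by_cases ha : a = T.winner
  · simp [rauzy, h, ha]
  · simp [rauzy, ha]

theorem sum_rauzy_len {T : IET A d} (h : T.len T.loser < T.len T.winner) (s : Finset A) :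
    ∑ b ∈ s, T.rauzy.len b =
      ∑ b ∈ s, T.len b - if T.winner ∈ s then T.len T.loser else 0 := by
  simp [rauzy_len h, Finset.sum_sub_distrib]

theorem rauzy_total {T : IET A d} (h : T.len T.loser < T.len T.winner) :
    T.rauzy.total = T.total - T.len T.loser := by
  simp [total, sum_rauzy_len h]

theorem rauzy_left_type {T : IET A d} (h : T.len T.loser < T.len T.winner) (a : A) :
    T.rauzy.left T.type a = T.left T.type a := by
  unfold left cut
  rw [sum_rauzy_len h, rauzy_perm_type, if_neg, sub_zero]
  simp only [Finset.mem_filter, Finset.mem_univ, true_and, winner, perm_last]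
  have := (T.perm T.type a).isLt
  omega

/-- The left endpoints in the row of the loser do not move either: an interval to the right of the
winner has the loser inserted before it, and the winner shortened by the same length. -/
theorem rauzy_left_not_type {T : IET A d} (h : T.len T.loser < T.len T.winner) {a : A}
    (ha : a ≠ T.loser) : T.rauzy.left (!T.type) a = T.left (!T.type) a := by
  have hl : (T.perm (!T.type) T.loser : ℕ) = d - 1 := T.perm_last _
  have hlt : ∀ b, b ≠ T.loser → (T.perm (!T.type) b : ℕ) < d - 1 := by
    intro b hb
    have h1 := (T.perm (!T.type) b).isLt
    have h2 : (T.perm (!T.type) b : ℕ) ≠ d - 1 := fun h' => hb (T.eq_last_of_perm h')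
    omega
  have hw := hlt _ (loser_ne_winner h).symm
  have ha' := hlt a ha
  unfold left cut
  simp only [rauzy_perm_not_type]
  rw [sum_rauzy_len h]
  by_cases hle : (T.perm (!T.type) a : ℕ) ≤ T.perm (!T.type) T.winner
  · have hs : (Finset.univ.filter fun b => (shift (T.perm (!T.type) T.winner)
        (T.perm (!T.type) b) : ℕ) < shift (T.perm (!T.type) T.winner) (T.perm (!T.type) a)) =
        Finset.univ.filter fun b => (T.perm (!T.type) b : ℕ) < T.perm (!T.type) a := by
      ext b
      simp only [Finset.mem_filter, Finset.mem_univ, true_and, shift, hle, dite_true]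
      split_ifs <;> grind
    rw [hs, if_neg, sub_zero]
    simpa using hle
  · -- The loser now precedes `a`, which makes up for the loss of length of the winner.
    have hs : (Finset.univ.filter fun b => (shift (T.perm (!T.type) T.winner)
        (T.perm (!T.type) b) : ℕ) < shift (T.perm (!T.type) T.winner) (T.perm (!T.type) a)) =
        insert T.loser
          (Finset.univ.filter fun b => (T.perm (!T.type) b : ℕ) < T.perm (!T.type) a) := by
      ext b
      simp only [Finset.mem_filter, Finset.mem_univ, true_and, Finset.mem_insert, shift, hle, ha',
        dite_false, dite_true]
      by_cases hb : b = T.loser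
      · subst hb
        simp only [true_or, iff_true]
        split_ifs <;> grind
      · have := hlt b hb
        simp only [hb, false_or]
        split_ifs <;> grind
    rw [hs, if_pos, Finset.sum_insert, add_sub_cancel_left]
    · simp only [Finset.mem_filter, Finset.mem_univ, true_and]
      omega
    · simp only [Finset.mem_insert, Finset.mem_filter, Finset.mem_univ, true_and]
      omega

theorem rauzy_left_loser {T : IET A d} (h : T.len T.loser < T.len T.winner) :
    T.rauzy.left (!T.type) T.loser =
      T.left (!T.type) T.winner + T.len T.winner - T.len T.loser := by
  have hl : (T.perm (!T.type) T.loser : ℕ) = d - 1 := T.perm_last _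
  have hw : (T.perm (!T.type) T.winner : ℕ) < d - 1 := by
    have h1 := (T.perm (!T.type) T.winner).isLt
    have h2 : (T.perm (!T.type) T.winner : ℕ) ≠ d - 1 :=
      fun h' => loser_ne_winner h (T.eq_last_of_perm h').symm
    omega
  rw [← cut_succ]
  unfold left cut
  simp only [rauzy_perm_not_type]
  rw [sum_rauzy_len h]
  have hs : (Finset.univ.filter fun b => (shift (T.perm (!T.type) T.winner)
      (T.perm (!T.type) b) : ℕ) < shift (T.perm (!T.type) T.winner) (T.perm (!T.type) T.loser)) =
      Finset.univ.filter fun b =>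
        (T.perm (!T.type) b : ℕ) < (T.perm (!T.type) T.winner : ℕ) + 1 := by
    ext b
    simp only [Finset.mem_filter, Finset.mem_univ, true_and, shift, hl]
    split_ifs <;> grind
  rw [hs, if_pos]
  simp

/-- `R'` is obtained from `R` by a step of the induction with loser `v`: the new interval of name
`v` runs through the intervals of names `p` and `q` of `R` before it returns, and the other
intervals return as before. Both cases `(p, q) = (v, w)` (the winner `w` is in the top row) and
`(p, q) = (w, v)` (it is in the bottom row) have this form. -/
structure IsStep (R R' : IET A d) (v p q : A) : Prop where
  total_le : R'.total ≤ R.total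
  cell_subset : ∀ a, a ≠ v → R'.cell a ⊆ R.cell a
  left_eq : ∀ a, a ≠ v → R'.left false a = R.left false a
  jump_eq : ∀ a, a ≠ v → R'.jump a = R.jump a
  cell_loser_subset : R'.cell v ⊆ R.cell p
  add_jump_mem : ∀ x ∈ R'.cell v, x + R.jump p ∈ R.cell q ∧ R'.total ≤ x + R.jump p
  jump_loser : R'.jump v = R.jump p + R.jump q
  cover : ∀ a, ∀ x ∈ R.cell a, (a ≠ v ∧ x ∈ R'.cell a) ∨ (a = p ∧ x ∈ R'.cell v) ∨
    (a = q ∧ x - R.jump p ∈ R'.cell v)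
  left_loser : (p = v ∧ R'.left false v = R.left false v) ∨
    (q = v ∧ R'.left false v + R.jump p = R.left false v)

theorem isStep_rauzy {T : IET A d} (h : T.len T.loser < T.len T.winner) :
    IsStep T T.rauzy T.loser (if T.type then T.winner else T.loser)
      (if T.type then T.loser else T.winner) := by
  have hne := loser_ne_winner h
  have hv := T.len_pos T.loser
  have htot := rauzy_total h
  have hleft : ∀ ε a, a ≠ T.loser → T.rauzy.left ε a = T.left ε a := by
    intro ε a ha
    by_cases hε : ε = T.type
    · rw [hε, rauzy_left_type h]
    · obtain rfl : ε = !T.type := by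
        revert hε; cases ε <;> cases T.type <;> simp
      exact rauzy_left_not_type h ha
  have hlenw : T.rauzy.len T.winner = T.len T.winner - T.len T.loser := by simp [rauzy_len h]
  have hlen : ∀ a, a ≠ T.winner → T.rauzy.len a = T.len a := by
    intro a ha
    simp [rauzy_len h, ha]
  have hle : ∀ a, T.rauzy.len a ≤ T.len a := by
    intro a
    rw [rauzy_len h]
    split_ifs <;> linarith
  have e1 := rauzy_left_type h T.loser
  have e2 := rauzy_left_loser h
  have e3 : T.left T.type T.winner + T.len T.winner = T.total := T.left_last _
  have e4 : T.left (!T.type) T.loser + T.len T.loser = T.total := T.left_last _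
  have hlv := hlen _ hne
  have hcell : ∀ a, a ≠ T.loser → T.rauzy.cell a ⊆ T.cell a := by
    intro a ha x hx
    have := hle a
    have h1 := hx.1
    have h2 := hx.2
    rw [hleft _ _ ha] at h1 h2
    exact ⟨h1, by linarith⟩
  have hother : ∀ a, a ≠ T.loser → a ≠ T.winner → ∀ x ∈ T.cell a, x ∈ T.rauzy.cell a := by
    intro a h1 h2 x hx
    rw [cell, hleft _ _ h1, hlen a h2]
    exact hx
  cases ht : T.type
  · simp only [ht, Bool.not_false] at e1 e2 e3 e4
    simp only [Bool.false_eq_true, if_false]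
    refine ⟨by linarith, hcell, fun a ha => hleft _ _ ha,
      fun a ha => by rw [jump, jump, hleft _ _ ha, hleft _ _ ha], ?_, ?_, ?_, ?_, ?_⟩
    · rw [cell, cell, e1, hlv]
    · rintro x ⟨hx1, hx2⟩
      simp only [cell, jump, Set.mem_Ico]
      refine ⟨⟨?_, ?_⟩, ?_⟩ <;> linarith
    · simp only [jump]
      linarith
    · intro a x hx
      by_cases h1 : a = T.loser
      · subst h1
        refine Or.inr (Or.inl ⟨rfl, ?_⟩)
        rwa [cell, e1, hlv]
      by_cases h2 : a = T.winner
      · subst h2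
        by_cases h3 : x < T.left false T.winner + T.rauzy.len T.winner
        · refine Or.inl ⟨h1, ?_⟩
          rw [cell, hleft _ _ h1]
          exact ⟨hx.1, h3⟩
        · refine Or.inr (Or.inr ⟨rfl, ?_⟩)
          have h4 := hx.2
          simp only [cell, jump, Set.mem_Ico]
          constructor <;> linarith
      · exact Or.inl ⟨h1, hother a h1 h2 x hx⟩
    · exact Or.inl ⟨rfl, e1⟩
  · simp only [ht, Bool.not_true] at e1 e2 e3 e4
    simp only [if_true]
    refine ⟨by linarith, hcell, fun a ha => hleft _ _ ha,
      fun a ha => by rw [jump, jump, hleft _ _ ha, hleft _ _ ha], ?_, ?_, ?_, ?_, ?_⟩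
    · rintro x ⟨hx1, hx2⟩
      simp only [cell, Set.mem_Ico]
      constructor <;> linarith
    · rintro x ⟨hx1, hx2⟩
      simp only [cell, jump, Set.mem_Ico]
      refine ⟨⟨?_, ?_⟩, ?_⟩ <;> linarith
    · simp only [jump]
      linarith
    · intro a x hx
      by_cases h1 : a = T.loser
      · subst h1
        refine Or.inr (Or.inr ⟨rfl, ?_⟩)
        have h3 := hx.1
        have h4 := hx.2
        simp only [cell, jump, Set.mem_Ico]
        constructor <;> linarith
      by_cases h2 : a = T.winner
      · subst h2
        by_cases h3 : x < T.left false T.winner + T.rauzy.len T.winner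
        · refine Or.inl ⟨h1, ?_⟩
          rw [cell, hleft _ _ h1]
          exact ⟨hx.1, h3⟩
        · refine Or.inr (Or.inl ⟨rfl, ?_⟩)
          have h4 := hx.2
          simp only [cell, Set.mem_Ico]
          constructor <;> linarith
      · exact Or.inl ⟨h1, hother a h1 h2 x hx⟩
    · refine Or.inr ⟨rfl, ?_⟩
      simp only [jump]
      linarith

end RauzyStep

/-! ### Orbits of the left endpoints -/

theorem map_pow_add (T : IET A d) (i j : ℕ) (x : Set.Ico (0 : ℝ) T.total) :
    (T.map ^ i) ((T.map ^ j) x) = (T.map ^ (i + j)) x := by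
  rw [pow_add, Equiv.Perm.mul_apply]

theorem map_zpow_add (T : IET A d) (i j : ℤ) (x : Set.Ico (0 : ℝ) T.total) :
    (T.map ^ i) ((T.map ^ j) x) = (T.map ^ (i + j)) x := by
  rw [zpow_add, Equiv.Perm.mul_apply]

theorem zpow_injective_of_infinite_orbit {T : IET A d} {x : Set.Ico (0 : ℝ) T.total}
    (hx : (T.orbit x).Infinite) {i j : ℤ} (hij : (T.map ^ i) x = (T.map ^ j) x) : i = j := by
  by_contra hne
  refine hx ?_
  have hper : (T.map ^ (i - j)) x = x := by
    rw [sub_eq_neg_add, ← map_zpow_add, hij, map_zpow_add, neg_add_cancel, zpow_zero,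
      Equiv.Perm.one_apply]
  have hmul : ∀ k : ℤ, (T.map ^ ((i - j) * k)) x = x := by
    intro k
    rw [zpow_mul]
    exact Equiv.Perm.zpow_apply_eq_self_of_apply_eq_self hper k
  have hn : 0 < |i - j| := abs_pos.2 (sub_ne_zero.2 hne)
  refine ((Set.finite_Ico (0 : ℤ) |i - j|).image fun k => (T.map ^ k) x).subset ?_
  rintro _ ⟨k, rfl⟩
  refine ⟨k % (i - j), ⟨Int.emod_nonneg _ (sub_ne_zero.2 hne),
    Int.emod_lt_abs _ (sub_ne_zero.2 hne)⟩, ?_⟩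
  change _ = (T.map ^ k) x
  conv_rhs => rw [← Int.emod_add_mul_ediv k (i - j), ← map_zpow_add, hmul]

theorem map_leftPt_of_perm_zero (T : IET A d) {a b : A} (ha : (T.perm false a : ℕ) = 0)
    (hb : (T.perm true b : ℕ) = 0) : T.map (T.leftPt b) = T.leftPt a := by
  apply Subtype.ext
  rw [T.map_apply b _ le_rfl (lt_add_of_pos_right _ (T.len_pos b))]
  simp [leftPt, T.left_eq_zero ha, T.left_eq_zero hb]

theorem IsIrreducible.perm_false_ne_zero {T : IET A d} (hT : T.IsIrreducible) (hd : 2 ≤ d)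
    {b : A} (hb : (T.perm true b : ℕ) = 0) : (T.perm false b : ℕ) ≠ 0 := by
  intro hb'
  refine hT 1 le_rfl (by omega) ?_
  have key : ∀ ε, (T.perm ε b : ℕ) = 0 → {a | (T.perm ε a : ℕ) < 1} = {b} := by
    intro ε h
    ext a
    rw [Set.mem_ofPred_eq, Set.mem_singleton_iff, Nat.lt_one_iff, ← h, ← Fin.ext_iff,
      (T.perm ε).injective.eq_iff]
  rw [key _ hb, key _ hb']

theorem zpow_leftPt_injective {T : IET A d} (hd : 2 ≤ d) (hirr : T.IsIrreducible)
    (hK : T.Keane) (a : A) {i j : ℤ} (hij : (T.map ^ i) (T.leftPt a) = (T.map ^ j) (T.leftPt a)) :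
    i = j := by
  by_cases ha : (T.perm false a : ℕ) = 0
  · obtain ⟨b, hb⟩ := T.exists_perm_eq_zero true
    have h1 : T.leftPt a = (T.map ^ (1 : ℤ)) (T.leftPt b) := by
      rw [zpow_one, T.map_leftPt_of_perm_zero ha hb]
    rw [h1, map_zpow_add, map_zpow_add] at hij
    have := zpow_injective_of_infinite_orbit (hK.1 b (hirr.perm_false_ne_zero hd hb)) hij
    omega
  · exact zpow_injective_of_infinite_orbit (hK.1 a ha) hij

/-- Under the Keane condition no connection `T^s ℓ_a = T^t ℓ_b` with `s ≤ 0 < t` exists between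
different letters, the first letter being allowed for `b`. -/
theorem zpow_leftPt_ne {T : IET A d} (hd : 2 ≤ d) (hirr : T.IsIrreducible)
    (hK : T.Keane) {a b : A} (ha : (T.perm false a : ℕ) ≠ 0) (hab : a ≠ b) {s t : ℤ}
    (hs : s ≤ 0) (ht : 0 < t) : (T.map ^ s) (T.leftPt a) ≠ (T.map ^ t) (T.leftPt b) := by
  intro h
  by_cases hb : (T.perm false b : ℕ) = 0
  · obtain ⟨c, hc⟩ := T.exists_perm_eq_zero true
    have h1 : T.leftPt b = (T.map ^ (1 : ℤ)) (T.leftPt c) := by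
      rw [zpow_one, T.map_leftPt_of_perm_zero hb hc]
    rw [h1, map_zpow_add] at h
    by_cases hac : a = c
    · subst hac
      have := zpow_injective_of_infinite_orbit (hK.1 a ha) h
      omega
    · exact Set.disjoint_left.1 (hK.2 a c ha (hirr.perm_false_ne_zero hd hc) hac) ⟨s, rfl⟩
        ⟨_, h.symm⟩
  · exact Set.disjoint_left.1 (hK.2 a b ha hb hab) ⟨s, rfl⟩ ⟨_, h.symm⟩

/-! ### Rokhlin towers -/

/-- The exchange with data `R` is the first return map of `T` to `[0, |R|)`, the interval with label
`a` returning at time `h a`. Thus `[0, |T|)` is the union of towers, the one with label `a` having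
base `R.cell a` and height `h a`; the iterates of `T` are translations on its base up to the time of
return (`translate`), and `ℓ_a` is the left endpoint of one of its floors (`anchor`). -/
structure IsTower (T R : IET A d) (h : A → ℕ) : Prop where
  total_le : R.total ≤ T.total
  pos : ∀ a, 0 < h a
  translate : ∀ a, ∀ k ≤ h a, ∃ τ : ℝ, ∀ x : Set.Ico (0 : ℝ) T.total, (x : ℝ) ∈ R.cell a →
    ((T.map ^ k) x : ℝ) = x + τ
  ret : ∀ a, ∀ x : Set.Ico (0 : ℝ) T.total, (x : ℝ) ∈ R.cell a →
    ((T.map ^ h a) x : ℝ) = x + R.jump a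
  le_map : ∀ a, ∀ x : Set.Ico (0 : ℝ) T.total, (x : ℝ) ∈ R.cell a → ∀ k, 0 < k → k < h a →
    R.total ≤ (T.map ^ k) x
  cover : ∀ y : Set.Ico (0 : ℝ) T.total, ∃ a, ∃ s < h a, ∃ x : Set.Ico (0 : ℝ) T.total,
    (x : ℝ) ∈ R.cell a ∧ (T.map ^ s) x = y
  anchor : ∀ a, ∃ s < h a, ∃ x : Set.Ico (0 : ℝ) T.total,
    (x : ℝ) = R.left false a ∧ (T.map ^ s) x = T.leftPt a
  perm_zero : ∀ ε a, (R.perm ε a : ℕ) = 0 ↔ (T.perm ε a : ℕ) = 0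

theorem isTower_one (T : IET A d) : IsTower T T fun _ => 1 where
  total_le := le_rfl
  pos _ := one_pos
  translate a k hk := by
    interval_cases k
    · exact ⟨0, fun x _ => by simp⟩
    · refine ⟨T.jump a, fun x hx => ?_⟩
      rw [pow_one, T.map_apply a x hx.1 hx.2, jump]
      ring
  ret a x hx := by
    rw [pow_one, T.map_apply a x hx.1 hx.2, jump]
    ring
  le_map a x _ k h0 h1 := by omega
  cover y := by
    obtain ⟨a, ha⟩ := T.exists_mem_cell y.2.1 y.2.2
    exact ⟨a, 0, one_pos, y, ha, by simp⟩
  anchor a := ⟨0, one_pos, T.leftPt a, rfl, by simp⟩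
  perm_zero _ _ := Iff.rfl

theorem mem_Ico_of_mem_cell (R : IET A d) {a : A} {x L : ℝ} (hL : R.total ≤ L)
    (hx : x ∈ R.cell a) : x ∈ Set.Ico 0 L :=
  ⟨(R.left_nonneg false a).trans hx.1, (R.lt_total_of_mem_cell hx).trans_le hL⟩

theorem IsTower.step {T R R' : IET A d} {h h' : A → ℕ} {v p q : A} (H : IsTower T R h)
    (S : IsStep R R' v p q) (hne : ∀ a, a ≠ v → h' a = h a) (hv : h' v = h p + h q)
    (hperm : ∀ ε a, (R'.perm ε a : ℕ) = 0 ↔ (R.perm ε a : ℕ) = 0) : IsTower T R' h' where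
  total_le := S.total_le.trans H.total_le
  pos a := by
    by_cases ha : a = v
    · rw [ha, hv]
      exact Nat.add_pos_left (H.pos p) _
    · rw [hne a ha]
      exact H.pos a
  translate a k hk := by
    by_cases ha : a = v
    · subst ha
      rcases le_total k (h p) with hkp | hkp
      · obtain ⟨τ, hτ⟩ := H.translate p k hkp
        exact ⟨τ, fun x hx => hτ x (S.cell_loser_subset hx)⟩
      · obtain ⟨τ, hτ⟩ := H.translate q (k - h p) (by omega)
        refine ⟨R.jump p + τ, fun x hx => ?_⟩
        have h1 := H.ret p x (S.cell_loser_subset hx)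
        rw [show k = (k - h p) + h p by omega, ← map_pow_add, hτ, h1, add_assoc]
        rw [h1]
        exact (S.add_jump_mem x hx).1
    · rw [hne a ha] at hk
      obtain ⟨τ, hτ⟩ := H.translate a k hk
      exact ⟨τ, fun x hx => hτ x (S.cell_subset a ha hx)⟩
  ret a x hx := by
    by_cases ha : a = v
    · subst ha
      have h1 := H.ret p x (S.cell_loser_subset hx)
      rw [hv, add_comm, ← map_pow_add, H.ret q, h1, S.jump_loser, add_assoc]
      rw [h1]
      exact (S.add_jump_mem x hx).1
    · rw [hne a ha, H.ret a x (S.cell_subset a ha hx), S.jump_eq a ha]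
  le_map a x hx k h0 hk := by
    by_cases ha : a = v
    · subst ha
      have h1 := H.ret p x (S.cell_loser_subset hx)
      have h2 := S.add_jump_mem x hx
      rcases lt_trichotomy k (h p) with hkp | hkp | hkp
      · exact S.total_le.trans (H.le_map p x (S.cell_loser_subset hx) k h0 hkp)
      · rw [hkp, h1]
        exact h2.2
      · rw [show k = (k - h p) + h p by omega, ← map_pow_add]
        refine S.total_le.trans (H.le_map q _ ?_ _ (by omega) (by omega))
        rw [h1]
        exact h2.1
    · rw [hne a ha] at hk
      exact S.total_le.trans (H.le_map a x (S.cell_subset a ha hx) k h0 hk)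
  cover y := by
    obtain ⟨a, s, hs, x, hx, rfl⟩ := H.cover y
    rcases S.cover a x hx with ⟨ha, h1⟩ | ⟨rfl, h1⟩ | ⟨rfl, h1⟩
    · exact ⟨a, s, by rwa [hne a ha], x, h1, rfl⟩
    · exact ⟨v, s, by omega, x, h1, rfl⟩
    · let x' : Set.Ico (0 : ℝ) T.total :=
        ⟨x - R.jump p, mem_Ico_of_mem_cell R' (S.total_le.trans H.total_le) h1⟩
      have h2 : (T.map ^ h p) x' = x := by
        apply Subtype.ext
        rw [H.ret p x' (S.cell_loser_subset h1)]
        simp [x']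
      exact ⟨v, s + h p, by omega, x', h1, by rw [← map_pow_add, h2]⟩
  anchor a := by
    obtain ⟨s, hs, x, hx, hsx⟩ := H.anchor a
    by_cases ha : a = v
    · subst ha
      rcases S.left_loser with ⟨rfl, h1⟩ | ⟨rfl, h1⟩
      · exact ⟨s, by omega, x, by rw [h1, hx], hsx⟩
      · have h2 := R'.left_mem_cell q
        let x' : Set.Ico (0 : ℝ) T.total :=
          ⟨R'.left false q, mem_Ico_of_mem_cell R' (S.total_le.trans H.total_le) h2⟩
        have h3 : (T.map ^ h p) x' = x := by
          apply Subtype.ext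
          rw [H.ret p x' (S.cell_loser_subset h2), hx, ← h1]
        exact ⟨s + h p, by omega, x', rfl, by rw [← map_pow_add, h3, hsx]⟩
    · exact ⟨s, by rwa [hne a ha], x, by rw [S.left_eq a ha, hx], hsx⟩
  perm_zero ε a := (hperm ε a).trans (H.perm_zero ε a)

/-- A positive time of return to the base of the towers is at least the height of the tower. -/
theorem IsTower.height_le {T R : IET A d} {h : A → ℕ} (H : IsTower T R h) {a : A} {k : ℕ}
    {x : Set.Ico (0 : ℝ) T.total} (hx : (x : ℝ) ∈ R.cell a) (hk : 0 < k)
    (hlt : ((T.map ^ k) x : ℝ) < R.total) : h a ≤ k := by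
  by_contra hcon
  exact (H.le_map a x hx k hk (by omega)).not_gt hlt

/-- Under the Keane condition, the last intervals of the two rows of an induced exchange never
have the same length. -/
theorem IsTower.len_last_ne {T R : IET A d} {h : A → ℕ} (H : IsTower T R h) (hd : 2 ≤ d)
    (hirr : T.IsIrreducible) (hK : T.Keane) (hR : R.IsIrreducible) :
    R.len (R.last true) ≠ R.len (R.last false) := by
  intro heq
  obtain ⟨s, hs, x, hx, hsx⟩ := H.anchor (R.last false)
  obtain ⟨t, ht, y, hy, hty⟩ := H.anchor (R.last true)
  have h1 := R.left_last false
  have h2 := R.left_last true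
  have hxy : (T.map ^ h (R.last true)) y = x := by
    apply Subtype.ext
    rw [H.ret _ y (by rw [hy]; exact R.left_mem_cell _), hx, hy, jump]
    linarith
  have hfirst : (T.perm false (R.last false) : ℕ) ≠ 0 := by
    rw [Ne, ← H.perm_zero false, perm_last]
    omega
  refine zpow_leftPt_ne hd hirr hK hfirst (hR.last_ne hd) (s := -(s : ℤ))
    (t := (h (R.last true) : ℤ) - t) (by omega) (by omega) ?_
  rw [← hsx, ← hty, ← hxy, ← zpow_natCast, ← zpow_natCast, ← zpow_natCast, map_zpow_add,
    map_zpow_add, map_zpow_add]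
  congr 2
  ring

/-! ### The towers of Rauzy induction -/

variable [DecidableEq A]

theorem len_loser_lt {T : IET A d} (h : T.len (T.last true) ≠ T.len (T.last false)) :
    T.len T.loser < T.len T.winner := by
  by_cases h1 : T.len (T.last true) < T.len (T.last false)
  · have ht : T.type = false := if_pos h1
    simpa [loser, winner, ht] using h1
  · have ht : T.type = true := if_neg h1
    simpa [loser, winner, ht] using lt_of_le_of_ne (not_lt.1 h1) h.symm

/-- The return times of the intervals exchanged by `Rⁿ T` to `[0, |Rⁿ T|)` under `T`. -/
def height (T : IET A d) : ℕ → A → ℕ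
  | 0, _ => 1
  | n + 1, a => height T n a +
      if a = loser (rauzy^[n] T) then height T n (winner (rauzy^[n] T)) else 0

theorem isTower_height {T : IET A d} (hd : 2 ≤ d) (hirr : T.IsIrreducible) (hK : T.Keane)
    (n : ℕ) : IsTower T (rauzy^[n] T) (T.height n) ∧ IsIrreducible (rauzy^[n] T) := by
  induction n with
  | zero => exact ⟨T.isTower_one, hirr⟩
  | succ n ih =>
    obtain ⟨H, hR⟩ := ih
    have hlt := len_loser_lt (H.len_last_ne hd hirr hK hR)
    rw [Function.iterate_succ_apply']
    refine ⟨H.step (isStep_rauzy hlt) (fun a ha => by simp [height, ha]) ?_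
      (rauzy_perm_eq_zero_iff _), hR.rauzy⟩
    simp only [height, if_true]
    split_ifs
    · exact add_comm _ _
    · rfl

theorem len_loser_lt_len_winner {T : IET A d} (hd : 2 ≤ d) (hirr : T.IsIrreducible)
    (hK : T.Keane) (n : ℕ) :
    (rauzy^[n] T).len (loser (rauzy^[n] T)) < (rauzy^[n] T).len (winner (rauzy^[n] T)) := by
  obtain ⟨H, hR⟩ := isTower_height hd hirr hK n
  exact len_loser_lt (H.len_last_ne hd hirr hK hR)

/-! ### The cocycle, the lengths and the heights -/

theorem cocycle_self (T : IET A d) (n : ℕ) : T.cocycle n n = 1 := by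
  simp [cocycle]

theorem cocycle_succ (T : IET A d) {n n' : ℕ} (h : n ≤ n') :
    T.cocycle n (n' + 1) = T.cocycle n n' * theta (rauzy^[n'] T) := by
  rw [cocycle, Nat.sub_add_comm h, List.range'_1_concat, List.map_append, List.prod_append,
    Nat.add_sub_cancel' h]
  simp [cocycle]

theorem cocycle_mul (T : IET A d) {n n' n'' : ℕ} (h : n ≤ n') (h' : n' ≤ n'') :
    T.cocycle n n' * T.cocycle n' n'' = T.cocycle n n'' := by
  induction n'', h' using Nat.le_induction with
  | base => rw [cocycle_self, mul_one]
  | succ k hk ih => rw [cocycle_succ T hk, cocycle_succ T (h.trans hk), ← mul_assoc, ih]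

theorem mul_theta_apply (T : IET A d) (B : Matrix A A ℤ) (a b : A) :
    (B * T.theta) a b = B a b + if b = T.loser then B a T.winner else 0 := by
  rw [theta, mul_add, mul_one, Matrix.add_apply]
  congr 1
  split_ifs with h
  · rw [h, Matrix.mul_single_apply_same, mul_one]
  · exact Matrix.mul_single_apply_of_ne _ _ _ _ _ h _

theorem cocycle_succ_apply (T : IET A d) {n n' : ℕ} (h : n ≤ n') (a b : A) :
    T.cocycle n (n' + 1) a b = T.cocycle n n' a b +
      if b = loser (rauzy^[n'] T) then T.cocycle n n' a (winner (rauzy^[n'] T)) else 0 := by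
  rw [cocycle_succ T h, mul_theta_apply]

theorem cocycle_nonneg (T : IET A d) {n n' : ℕ} (h : n ≤ n') (a b : A) :
    0 ≤ T.cocycle n n' a b := by
  induction n', h using Nat.le_induction generalizing b with
  | base =>
    rw [cocycle_self, Matrix.one_apply]
    split_ifs <;> simp
  | succ k hk ih =>
    rw [cocycle_succ_apply T hk]
    split_ifs
    · exact add_nonneg (ih _) (ih _)
    · simpa using ih b

theorem cocycle_mono (T : IET A d) {n n' n'' : ℕ} (h : n ≤ n') (h' : n' ≤ n'') (a b : A) :
    T.cocycle n n' a b ≤ T.cocycle n n'' a b := by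
  induction n'', h' using Nat.le_induction with
  | base => rfl
  | succ k hk ih =>
    rw [cocycle_succ_apply T (h.trans hk)]
    refine ih.trans (le_add_of_nonneg_right ?_)
    split_ifs
    · exact T.cocycle_nonneg (h.trans hk) _ _
    · rfl

theorem one_le_cocycle_diag (T : IET A d) {n n' : ℕ} (h : n ≤ n') (a : A) :
    1 ≤ T.cocycle n n' a a := by
  simpa [cocycle_self] using T.cocycle_mono le_rfl h a a

theorem height_eq_sum (T : IET A d) {n n' : ℕ} (h : n ≤ n') (b : A) :
    (T.height n' b : ℤ) = ∑ a, (T.height n a : ℤ) * T.cocycle n n' a b := by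
  induction n', h using Nat.le_induction generalizing b with
  | base => simp [cocycle_self, Matrix.one_apply]
  | succ k hk ih =>
    simp only [cocycle_succ_apply T hk, mul_add, Finset.sum_add_distrib, ← ih, height]
    split_ifs with hb
    · rw [← ih]
      push_cast
      rfl
    · simp

theorem cocycle_mul_height_le (T : IET A d) {n n' : ℕ} (h : n ≤ n') (a b : A) :
    (T.height n a : ℤ) * T.cocycle n n' a b ≤ T.height n' b := by
  rw [T.height_eq_sum h]
  exact Finset.single_le_sum
    (f := fun a => (T.height n a : ℤ) * T.cocycle n n' a b)
    (fun c _ => mul_nonneg (Int.natCast_nonneg _) (T.cocycle_nonneg h c b)) (Finset.mem_univ a)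

theorem len_eq_add {T : IET A d} (h : T.len T.loser < T.len T.winner) (a : A) :
    T.len a = T.rauzy.len a + if a = T.winner then T.rauzy.len T.loser else 0 := by
  rw [rauzy_len h a, rauzy_len h T.loser, if_neg (loser_ne_winner h), sub_zero, sub_add_cancel]

theorem len_eq_sum {T : IET A d} (hd : 2 ≤ d) (hirr : T.IsIrreducible) (hK : T.Keane)
    {n n' : ℕ} (h : n ≤ n') (a : A) :
    (rauzy^[n] T).len a = ∑ b, (T.cocycle n n' a b : ℝ) * (rauzy^[n'] T).len b := by
  induction n', h using Nat.le_induction with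
  | base => simp [cocycle_self, Matrix.one_apply]
  | succ k hk ih =>
    have hlt := len_loser_lt_len_winner hd hirr hK k
    simp only [ih, len_eq_add hlt, cocycle_succ_apply T hk, Function.iterate_succ_apply',
      Int.cast_add, mul_add, add_mul, Finset.sum_add_distrib]
    simp

/-- The towers fill `[0, |λ|)`. -/
theorem sum_height_mul_len {T : IET A d} (hd : 2 ≤ d) (hirr : T.IsIrreducible) (hK : T.Keane)
    (n : ℕ) : ∑ a, (T.height n a : ℝ) * (rauzy^[n] T).len a = T.total := by
  have h1 : ∀ a, (T.height n a : ℝ) = ∑ b, (T.cocycle 0 n b a : ℝ) := by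
    intro a
    have := T.height_eq_sum (Nat.zero_le n) a
    simp only [height, Nat.cast_one, one_mul] at this
    exact_mod_cast this
  simp only [h1, Finset.sum_mul]
  rw [Finset.sum_comm, total]
  exact Finset.sum_congr rfl fun b _ => (len_eq_sum hd hirr hK (Nat.zero_le n) b).symm

/-- The length of an interval is unchanged as long as its letter does not win. -/
theorem len_eq_of_notMem_names {T : IET A d} (hd : 2 ≤ d) (hirr : T.IsIrreducible)
    (hK : T.Keane) {n n' : ℕ} (h : n ≤ n') {a : A} (ha : a ∉ T.names n n') :
    (rauzy^[n'] T).len a = (rauzy^[n] T).len a := by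
  induction n', h using Nat.le_induction with
  | base => rfl
  | succ k hk ih =>
    have h1 : a ∉ T.names n k := fun h' =>
      ha (Finset.image_subset_image (Finset.Ico_subset_Ico_right (Nat.le_succ k)) h')
    have h2 : a ≠ winner (rauzy^[k] T) := fun h' =>
      ha (Finset.mem_image.2 ⟨k, Finset.mem_Ico.2 ⟨hk, Nat.lt_succ_self k⟩, h'.symm⟩)
    rw [Function.iterate_succ_apply', rauzy_len (len_loser_lt_len_winner hd hirr hK k),
      if_neg h2, sub_zero, ih h1]

theorem sub_le_sum_cocycle (T : IET A d) {n n' : ℕ} (h : n ≤ n') :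
    (n' : ℤ) - n ≤ ∑ a, ∑ b, T.cocycle n n' a b := by
  induction n', h using Nat.le_induction with
  | base =>
    rw [sub_self]
    exact Finset.sum_nonneg fun a _ => Finset.sum_nonneg fun b _ => T.cocycle_nonneg le_rfl a b
  | succ k hk ih =>
    have h1 : 1 ≤ ∑ a, T.cocycle n k a (winner (rauzy^[k] T)) :=
      (T.one_le_cocycle_diag hk _).trans (Finset.single_le_sum
        (f := fun a => T.cocycle n k a (winner (rauzy^[k] T)))
        (fun a _ => T.cocycle_nonneg hk a _) (Finset.mem_univ _))
    simp only [cocycle_succ_apply T hk, Finset.sum_add_distrib, Finset.sum_ite_eq',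
      Finset.mem_univ, if_true]
    push_cast
    linarith

/-! ### Partitions into intervals -/

theorem bounds_of_mem_atoms {L : ℝ} {S : Set ℝ} {p : ℝ × ℝ} (hp : p ∈ atoms L S)
    (hL : 0 < L) (hS : S ⊆ Set.Ico 0 L) : 0 ≤ p.1 ∧ p.2 ≤ L := by
  have h : ∀ z ∈ S ∪ {0, L}, 0 ≤ z ∧ z ≤ L := by
    rintro z (hz | rfl | rfl)
    · exact ⟨(hS hz).1, (hS hz).2.le⟩
    · exact ⟨le_rfl, hL.le⟩
    · exact ⟨hL.le, le_rfl⟩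
  exact ⟨(h _ hp.1).1, (h _ hp.2.1).2⟩

/-- An interval free of points of `S` lies in an atom. -/
theorem exists_atom {L : ℝ} {S : Set ℝ} (hfin : S.Finite) {x y : ℝ} (hx : 0 ≤ x) (hxy : x < y)
    (hy : y ≤ L) (hgap : ∀ z ∈ S, ¬ (x < z ∧ z < y)) :
    ∃ p ∈ atoms L S, p.1 ≤ x ∧ y ≤ p.2 := by
  have hfin' : (S ∪ {0, L}).Finite := hfin.union (Set.toFinite _)
  obtain ⟨u, ⟨hu, hux⟩, hmax⟩ := (hfin'.inter_of_left (Set.Iic x)).exists_maximal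
    ⟨0, Or.inr (Or.inl rfl), hx⟩
  obtain ⟨v, ⟨hv, hvy⟩, hmin⟩ := (hfin'.inter_of_left (Set.Ici y)).exists_minimal
    ⟨L, Or.inr (Or.inr rfl), hy⟩
  refine ⟨(u, v), ⟨hu, hv, lt_of_le_of_lt hux (hxy.trans_le hvy), ?_⟩, hux, hvy⟩
  rintro z hz ⟨h1, h2⟩
  have hxz : x < z := lt_of_not_ge fun h => (hmax ⟨hz, h⟩ h1.le).not_gt h1
  have hzy : z < y := lt_of_not_ge fun h => (hmin ⟨hz, h⟩ h2.le).not_gt h2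
  rcases hz with hz | rfl | rfl
  · exact hgap z hz ⟨hxz, hzy⟩
  · exact hxz.not_ge hx
  · exact hzy.not_ge hy

/-- A point of `S ∪ {0, L}` that is not the largest one is the left endpoint of an atom. -/
theorem exists_atom_left {L : ℝ} {S : Set ℝ} (hfin : S.Finite) {x y : ℝ} (hx : x ∈ S ∪ {0, L})
    (hy : y ∈ S ∪ {0, L}) (hxy : x < y) : ∃ v, (x, v) ∈ atoms L S ∧ v ≤ y := by
  have hfin' : (S ∪ {0, L}).Finite := hfin.union (Set.toFinite _)
  obtain ⟨v, ⟨hv, hxv⟩, hmin⟩ := (hfin'.inter_of_left (Set.Ioi x)).exists_minimal ⟨y, hy, hxy⟩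
  have hle : ∀ z ∈ S ∪ {0, L}, x < z → v ≤ z := fun z hz hxz =>
    (le_total v z).elim id fun h => hmin ⟨hz, hxz⟩ h
  exact ⟨v, ⟨hx, hv, hxv, fun z hz hz' => (hle z hz hz'.1).not_gt hz'.2⟩, hle y hy hxy⟩

theorem minLength_le {L : ℝ} {S : Set ℝ} (hfin : S.Finite) {x y : ℝ} (hx : x ∈ S ∪ {0, L})
    (hy : y ∈ S ∪ {0, L}) (hxy : x < y) : minLength (atoms L S) ≤ y - x := by
  obtain ⟨v, hv, hvy⟩ := exists_atom_left hfin hx hy hxy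
  refine (csInf_le ⟨0, ?_⟩ (Set.mem_image_of_mem _ hv)).trans (sub_le_sub_right hvy x)
  rintro _ ⟨p, hp, rfl⟩
  exact sub_nonneg.2 hp.2.2.1.le

theorem le_maxLength {L : ℝ} {S : Set ℝ} (hL : 0 < L) (hS : S ⊆ Set.Ico 0 L) {p : ℝ × ℝ}
    (hp : p ∈ atoms L S) : p.2 - p.1 ≤ maxLength (atoms L S) := by
  refine le_csSup ⟨L, ?_⟩ (Set.mem_image_of_mem _ hp)
  rintro _ ⟨q, hq, rfl⟩
  have := bounds_of_mem_atoms hq hL hS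
  simp only
  linarith

/-- Criterion for balanced lengths in terms of the separation and of the density of `S`. -/
theorem isBalanced_atoms {L c : ℝ} {n : ℕ} {S : Set ℝ} (hL : 0 < L) (hfin : S.Finite)
    (hS : S ⊆ Set.Ico 0 L) {δ η : ℝ} (hδ : 1 / (c * n) < δ) (hη : η < c / n)
    (hsep : ∀ x ∈ S ∪ {0, L}, ∀ y ∈ S ∪ {0, L}, x < y → δ ≤ y - x)
    (hdense : ∀ x y, 0 ≤ x → y ≤ L → η < y - x → ∃ z ∈ S, x < z ∧ z < y) :
    IsBalanced c n (atoms L S) := by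
  obtain ⟨v, hv, -⟩ := exists_atom_left (L := L) hfin (Or.inr (Or.inl rfl) : (0 : ℝ) ∈ _)
    (Or.inr (Or.inr rfl)) hL
  have hne : ((fun p : ℝ × ℝ => p.2 - p.1) '' atoms L S).Nonempty := ⟨_, _, hv, rfl⟩
  refine ⟨hδ.trans_le (le_csInf hne ?_), ?_, (csSup_le hne ?_).trans_lt hη⟩
  · rintro _ ⟨p, hp, rfl⟩
    exact hsep _ hp.1 _ hp.2.1 hp.2.2.1
  · exact (minLength_le hfin hv.1 hv.2.1 hv.2.2.1).trans (le_maxLength hL hS hv)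
  · rintro _ ⟨p, hp, rfl⟩
    by_contra hlt
    have h1 := bounds_of_mem_atoms hp hL hS
    obtain ⟨z, hz, hz'⟩ := hdense p.1 p.2 h1.1 h1.2 (not_le.1 hlt)
    exact hp.2.2.2 z (Or.inl hz) hz'

theorem preimages_subset (T : IET A d) (a : A) (n : ℕ) (j : ℤ) :
    T.preimages a n j ⊆ Set.Ico 0 T.total := by
  rintro _ ⟨k, -, rfl⟩
  exact Subtype.prop _

theorem finite_preimages (T : IET A d) (a : A) (n : ℕ) (j : ℤ) : (T.preimages a n j).Finite := by
  refine ((Set.finite_Iio n).image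
    fun k : ℕ => (((T.map ^ (-(k : ℤ) + j)) (T.leftPt a) : Set.Ico (0 : ℝ) T.total) : ℝ)).subset ?_
  rintro _ ⟨k, hk, rfl⟩
  exact ⟨k, hk, rfl⟩

theorem mem_preimages (T : IET A d) (a : A) {n : ℕ} {j i : ℤ} (h1 : j - n < i) (h2 : i ≤ j) :
    ((T.map ^ i) (T.leftPt a) : ℝ) ∈ T.preimages a n j :=
  ⟨(j - i).toNat, by omega, by rw [Int.toNat_of_nonneg (by omega)]; simp⟩

/-! ### Balanced partition lengths imply bounded type -/

theorem card_eq (T : IET A d) : Fintype.card A = d := by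
  rw [Fintype.card_congr (T.perm false), Fintype.card_fin]

theorem exists_notMem_of_card_le {T : IET A d} {s : Finset A} (hs : s.card ≤ d - 1) :
    ∃ a, a ∉ s := by
  by_contra! h
  have h1 : s = Finset.univ := Finset.eq_univ_iff_forall.2 h
  rw [h1, Finset.card_univ, T.card_eq] at hs
  have := T.one_le
  omega

/-- The endpoints of the exchanged intervals lie on the orbits of the `ℓ_a`, at times bounded by the
height of the tower. -/
theorem IsTower.exists_left_eq {T R : IET A d} {h : A → ℕ} (H : IsTower T R h) (ε : Bool)
    (a : A) : ∃ i : ℤ, |i| ≤ h a ∧ R.left ε a = (T.map ^ i) (T.leftPt a) := by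
  obtain ⟨s, hs, x, hx, hsx⟩ := H.anchor a
  have key : ∀ k : ℕ, (T.map ^ ((k : ℤ) - s)) (T.leftPt a) = (T.map ^ k) x := by
    intro k
    rw [← hsx, ← zpow_natCast, ← zpow_natCast, map_zpow_add, sub_add_cancel]
  cases ε
  · refine ⟨((0 : ℕ) : ℤ) - s, ?_, ?_⟩
    · rw [abs_le]
      omega
    · rw [key, pow_zero, Equiv.Perm.one_apply, hx]
  · refine ⟨(h a : ℤ) - s, ?_, ?_⟩
    · rw [abs_le]
      omega
    · rw [key, H.ret a x (by rw [hx]; exact R.left_mem_cell a), hx, jump]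
      ring

/-- Balanced lengths separate the points of a finite piece of the orbits of the `ℓ_a`. -/
theorem separation_of_balanced {T : IET A d} {c : ℝ}
    (hc : ∀ n j : ℕ, j < n → IsBalanced c n (T.partitionAll n j)) {a b : A} {i k : ℤ} {N : ℕ}
    (hi : |i| ≤ N) (hk : |k| ≤ N)
    (hlt : ((T.map ^ i) (T.leftPt a) : ℝ) < (T.map ^ k) (T.leftPt b)) :
    1 / (c * (2 * N + 1)) < ((T.map ^ k) (T.leftPt b) : ℝ) - (T.map ^ i) (T.leftPt a) := by
  rw [abs_le] at hi hk
  have h1 := (hc (2 * N + 1) N (by omega)).1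
  push_cast at h1
  refine h1.trans_le (minLength_le (Set.finite_iUnion fun a => T.finite_preimages a _ _)
    (Or.inl (Set.mem_iUnion.2 ⟨a, ?_⟩)) (Or.inl (Set.mem_iUnion.2 ⟨b, ?_⟩)) hlt)
  · exact T.mem_preimages a (by push_cast; omega) hi.2
  · exact T.mem_preimages b (by push_cast; omega) hk.2

/-- The tower with label `a` consists of `h a` consecutive points of the orbit of `ℓ_a`, all but one
of which avoid the base. -/
theorem IsTower.height_mul_total_lt {T R : IET A d} {h : A → ℕ} (H : IsTower T R h) {c : ℝ}
    (hc : ∀ n j : ℕ, j < n → ∀ a, IsBalanced c n (T.partitionOne a n j)) (a : A) :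
    h a * R.total < 2 * c := by
  obtain ⟨s, hs, x, hx, hsx⟩ := H.anchor a
  have hpos : (0 : ℝ) < h a := by exact_mod_cast H.pos a
  have hmem : (x : ℝ) ∈ R.cell a := by
    rw [hx]
    exact R.left_mem_cell a
  have hS : ∀ z ∈ T.preimages a (h a) ((h a - s - 1 : ℕ) : ℤ), z = x ∨ R.total ≤ z := by
    rintro _ ⟨k, hk, rfl⟩
    have h1 : (T.map ^ (-(k : ℤ) + ((h a - s - 1 : ℕ) : ℤ))) (T.leftPt a) =
        (T.map ^ (h a - 1 - k)) x := by
      rw [← hsx, ← zpow_natCast, ← zpow_natCast, map_zpow_add]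
      congr 2
      omega
    rw [h1]
    rcases Nat.eq_zero_or_pos (h a - 1 - k) with h2 | h2
    · exact Or.inl (by rw [h2, pow_zero, Equiv.Perm.one_apply])
    · exact Or.inr (H.le_map a x hmem _ h2 (by omega))
  have hR := R.total_pos
  have hgap : ∃ u, 0 ≤ u ∧ u + R.total / 2 ≤ R.total ∧
      ∀ z ∈ T.preimages a (h a) ((h a - s - 1 : ℕ) : ℤ), ¬ (u < z ∧ z < u + R.total / 2) := by
    by_cases hx2 : (x : ℝ) < R.total / 2
    · refine ⟨R.total / 2, by linarith, by linarith, fun z hz hz' => ?_⟩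
      rcases hS z hz with h1 | h1 <;> linarith [hz'.1, hz'.2]
    · refine ⟨0, le_rfl, by linarith, fun z hz hz' => ?_⟩
      rcases hS z hz with h1 | h1 <;> linarith [hz'.1, hz'.2]
  obtain ⟨u, hu0, hu1, hu⟩ := hgap
  obtain ⟨p, hp, hp1, hp2⟩ := exists_atom (T.finite_preimages a _ _) hu0
    (lt_add_of_pos_right u (half_pos hR)) (hu1.trans H.total_le) hu
  have h1 := le_maxLength T.total_pos (T.preimages_subset a _ _) hp
  have h2 := (hc (h a) (h a - s - 1) (by omega) a).2.2
  rw [partitionOne] at h2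
  have h3 : R.total / 2 < c / h a := by linarith
  rw [lt_div_iff₀ hpos] at h3
  linarith

/-- The first return of `ℓ_a` to the base produces two different points of its orbit at a distance
less than `|R|`. -/
theorem IsTower.one_lt_mul_height {T R : IET A d} {h : A → ℕ} (H : IsTower T R h) (hd : 2 ≤ d)
    (hirr : T.IsIrreducible) (hK : T.Keane) {c : ℝ} (hc0 : 0 < c)
    (hc : ∀ n j : ℕ, j < n → IsBalanced c n (T.partitionAll n j)) (a : A) :
    1 < 3 * c * h a * R.total := by
  obtain ⟨s, hs, x, hx, hsx⟩ := H.anchor a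
  have hmem : (x : ℝ) ∈ R.cell a := by
    rw [hx]
    exact R.left_mem_cell a
  have key : ∀ k : ℕ, (T.map ^ ((k : ℤ) - s)) (T.leftPt a) = (T.map ^ k) x := by
    intro k
    rw [← hsx, ← zpow_natCast, ← zpow_natCast, map_zpow_add, sub_add_cancel]
  have hx0 : ((T.map ^ (((0 : ℕ) : ℤ) - s)) (T.leftPt a) : ℝ) = R.left false a := by
    rw [key, pow_zero, Equiv.Perm.one_apply, hx]
  have hx1 : ((T.map ^ ((h a : ℤ) - s)) (T.leftPt a) : ℝ) = R.left true a := by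
    rw [key, H.ret a x hmem, hx, jump]
    ring
  have hne : R.left false a ≠ R.left true a := by
    rw [← hx0, ← hx1]
    intro heq
    have := zpow_leftPt_injective hd hirr hK a (Subtype.ext heq)
    omega
  have habs0 : |((0 : ℕ) : ℤ) - s| ≤ h a := by
    rw [abs_le]
    omega
  have habs1 : |(h a : ℤ) - s| ≤ h a := by
    rw [abs_le]
    omega
  have hlt : 1 / (c * (2 * h a + 1)) < R.total := by
    rcases hne.lt_or_gt with hlt | hlt
    · rw [← hx0, ← hx1] at hlt
      have h1 := separation_of_balanced hc habs0 habs1 hlt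
      rw [hx0, hx1] at h1
      linarith [R.left_nonneg false a, R.left_lt_total true a]
    · rw [← hx0, ← hx1] at hlt
      have h1 := separation_of_balanced hc habs1 habs0 hlt
      rw [hx0, hx1] at h1
      linarith [R.left_nonneg true a, R.left_lt_total false a]
  have hpos : (1 : ℝ) ≤ h a := by exact_mod_cast H.pos a
  rw [div_lt_iff₀ (by positivity)] at hlt
  have h3 : R.total * (c * (2 * h a + 1)) ≤ R.total * (c * (3 * h a)) := by
    have := R.total_pos
    gcongr
    linarith
  linarith

/-- The two endpoints of an exchanged interval are separated points of the orbits of the `ℓ_b`. -/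
theorem IsTower.total_le_mul_len {T R : IET A d} {h : A → ℕ} (H : IsTower T R h) (hd : 2 ≤ d)
    (hR : R.IsIrreducible) {c : ℝ} (hc0 : 0 < c)
    (hc : ∀ n j : ℕ, j < n →
      (∀ a, IsBalanced c n (T.partitionOne a n j)) ∧ IsBalanced c n (T.partitionAll n j))
    (a : A) : R.total ≤ 6 * c ^ 2 * R.len a := by
  obtain ⟨m, -, hm⟩ := Finset.univ.exists_max_image h ⟨a, Finset.mem_univ a⟩
  -- By irreducibility `a` is followed by another letter in one of the two rows.
  have hrow : ∃ ε, (R.perm ε a : ℕ) + 1 < d := by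
    by_contra! hcon
    refine hR.last_ne hd ?_
    rw [← R.eq_last_of_perm (ε := false) (a := a), ← R.eq_last_of_perm (ε := true) (a := a)]
    · have := hcon true; have := (R.perm true a).isLt; omega
    · have := hcon false; have := (R.perm false a).isLt; omega
  obtain ⟨ε, hε⟩ := hrow
  obtain ⟨b, hb⟩ : ∃ b, (R.perm ε b : ℕ) = R.perm ε a + 1 :=
    ⟨(R.perm ε).symm ⟨R.perm ε a + 1, hε⟩, by simp⟩
  have hba : R.left ε b = R.left ε a + R.len a := by
    rw [← R.cut_succ, ← hb, left]
  obtain ⟨i, hi, hia⟩ := H.exists_left_eq ε a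
  obtain ⟨k, hk, hkb⟩ := H.exists_left_eq ε b
  have ha := R.len_pos a
  have hsep := separation_of_balanced (fun n j hj => (hc n j hj).2)
    (hi.trans (by exact_mod_cast hm a (Finset.mem_univ a)))
    (hk.trans (by exact_mod_cast hm b (Finset.mem_univ b)))
    (by rw [← hia, ← hkb, hba]; linarith)
  rw [← hia, ← hkb, hba, add_sub_cancel_left] at hsep
  have hmax := H.height_mul_total_lt (fun n j hj => (hc n j hj).1) m
  have hpos : (1 : ℝ) ≤ h m := by exact_mod_cast H.pos m
  rw [div_lt_iff₀ (by positivity)] at hsep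
  have h3 : R.len a * (c * (2 * h m + 1)) ≤ R.len a * (c * (3 * h m)) := by
    gcongr
    linarith
  have hRpos := R.total_pos
  calc R.total ≤ R.len a * (c * (3 * h m)) * R.total :=
        le_mul_of_one_le_left hRpos.le (by linarith)
    _ = 3 * c * R.len a * (h m * R.total) := by ring
    _ ≤ 3 * c * R.len a * (2 * c) := by gcongr
    _ = 6 * c ^ 2 * R.len a := by ring

/-- If some letter does not win between two times, the cocycle between them is bounded. -/
theorem cocycle_le_of_balanced {T : IET A d} (hd : 2 ≤ d) (hirr : T.IsIrreducible)
    (hK : T.Keane) {c : ℝ} (hc0 : 0 < c)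
    (hc : ∀ n j : ℕ, j < n →
      (∀ a, IsBalanced c n (T.partitionOne a n j)) ∧ IsBalanced c n (T.partitionAll n j))
    {n n' : ℕ} (h : n ≤ n') (hcard : (T.names n n').card ≤ d - 1) (a b : A) :
    (T.cocycle n n' a b : ℝ) ≤ 36 * c ^ 4 := by
  obtain ⟨e, he⟩ := exists_notMem_of_card_le (T := T) hcard
  obtain ⟨H, hR⟩ := isTower_height hd hirr hK n
  obtain ⟨H', -⟩ := isTower_height hd hirr hK n'
  have h1 := H.one_lt_mul_height hd hirr hK hc0 (fun n j hj => (hc n j hj).2) a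
  have h2 := H'.height_mul_total_lt (fun n j hj => (hc n j hj).1) b
  have h3 := H.total_le_mul_len hd hR hc0 hc e
  rw [← len_eq_of_notMem_names hd hirr hK h he] at h3
  have h4 : (rauzy^[n'] T).len e ≤ (rauzy^[n'] T).total :=
    Finset.single_le_sum (fun b _ => (len_pos _ b).le) (Finset.mem_univ e)
  have h5 : (T.height n a : ℝ) * T.cocycle n n' a b ≤ T.height n' b := by
    exact_mod_cast T.cocycle_mul_height_le h a b
  have hB : (0 : ℝ) ≤ T.cocycle n n' a b := by exact_mod_cast T.cocycle_nonneg h a b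
  have ht := (rauzy^[n] T).total_pos
  have ht' := (rauzy^[n'] T).total_pos
  calc (T.cocycle n n' a b : ℝ)
      ≤ 3 * c * T.height n a * (rauzy^[n] T).total * T.cocycle n n' a b :=
        le_mul_of_one_le_left hB h1.le
    _ = 3 * c * (rauzy^[n] T).total * (T.height n a * T.cocycle n n' a b) := by ring
    _ ≤ 3 * c * (6 * c ^ 2 * (rauzy^[n'] T).total) * T.height n' b := by
        gcongr
        exact h3.trans (by gcongr)
    _ = 18 * c ^ 3 * (T.height n' b * (rauzy^[n'] T).total) := by ring
    _ ≤ 18 * c ^ 3 * (2 * c) := by gcongr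
    _ = 36 * c ^ 4 := by ring

theorem exists_isAcceleration {T : IET A d} {D : ℕ}
    (h : ∀ m, BddAbove {n | m ≤ n ∧ (T.names m n).card ≤ D}) : ∃ m, T.IsAcceleration D m := by
  have hg : ∀ m, IsGreatest {n | m ≤ n ∧ (T.names m n).card ≤ D}
      (sSup {n | m ≤ n ∧ (T.names m n).card ≤ D}) := fun m =>
    ⟨Nat.sSup_mem ⟨m, le_rfl, by simp [names]⟩ (h m), fun n hn => le_csSup (h m) hn⟩
  refine ⟨fun k => (fun m => sSup {n | m ≤ n ∧ (T.names m n).card ≤ D})^[k] 0, rfl, fun k => ?_⟩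
  simp only [Function.iterate_succ_apply']
  exact hg _

theorem HasBalancedPartitionLengths.isBoundedType {T : IET A d} (hd : 2 ≤ d)
    (hirr : T.IsIrreducible) (hK : T.Keane) (hT : T.HasBalancedPartitionLengths) :
    T.IsBoundedType := by
  obtain ⟨c, hc0, hc⟩ := hT
  have hbdd : ∀ m, BddAbove {n | m ≤ n ∧ (T.names m n).card ≤ d - 1} := by
    -- The sum of the entries of `B(m, n)` is at least `n - m`.
    intro m
    refine ⟨m + ⌈∑ _a : A, ∑ _b : A, 36 * c ^ 4⌉₊, ?_⟩
    rintro n ⟨hmn, hcard⟩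
    have h1 : ((n : ℝ) - m) ≤ ∑ a, ∑ b, (T.cocycle m n a b : ℝ) := by
      exact_mod_cast T.sub_le_sum_cocycle hmn
    have h2 : ∑ a, ∑ b, (T.cocycle m n a b : ℝ) ≤ ∑ _a : A, ∑ _b : A, 36 * c ^ 4 :=
      Finset.sum_le_sum fun a _ => Finset.sum_le_sum fun b _ =>
        cocycle_le_of_balanced hd hirr hK hc0 hc hmn hcard a b
    have h3 := Nat.le_ceil (∑ _a : A, ∑ _b : A, 36 * c ^ 4)
    have h4 : (n : ℝ) ≤ m + (⌈∑ _a : A, ∑ _b : A, 36 * c ^ 4⌉₊ : ℝ) := by linarith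
    exact_mod_cast h4
  obtain ⟨m, hm⟩ := exists_isAcceleration hbdd
  refine ⟨m, hm, 36 * c ^ 4, by positivity, fun k a b => ?_⟩
  have hk := (hm.2 k).1
  rw [abs_of_nonneg (by exact_mod_cast T.cocycle_nonneg hk.1 a b)]
  exact cocycle_le_of_balanced hd hirr hK hc0 hc hk.1 hk.2 a b

/-! ### Positivity of the accelerated cocycle -/

theorem rauzy_last_type (T : IET A d) : T.rauzy.last T.type = T.winner := by
  rw [last, rauzy_perm_type]
  rfl

theorem loser_rauzy_of_winner_ne (T : IET A d) (h : T.rauzy.winner ≠ T.winner) :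
    T.rauzy.loser = T.winner := by
  by_cases ht : T.rauzy.type = T.type
  · exact absurd (by rw [winner, ht, rauzy_last_type]) h
  · have ht' : (!T.rauzy.type) = T.type := by
      revert ht
      cases T.rauzy.type <;> cases T.type <;> simp
    rw [loser, ht', rauzy_last_type]

/-- The letters `b` for which the entry of the cocycle at `(a, b)` is positive. -/
def reach (T : IET A d) (p : ℕ) (a : A) (n : ℕ) : Finset A :=
  Finset.univ.filter fun b => 0 < T.cocycle p n a b

theorem mem_reach {T : IET A d} {p : ℕ} {a : A} {n : ℕ} {b : A} :
    b ∈ T.reach p a n ↔ 0 < T.cocycle p n a b := by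
  simp [reach]

theorem reach_mono (T : IET A d) {p n n' : ℕ} (a : A) (h : p ≤ n) (h' : n ≤ n') :
    T.reach p a n ⊆ T.reach p a n' := fun b hb =>
  mem_reach.2 ((mem_reach.1 hb).trans_le (T.cocycle_mono h h' a b))

theorem loser_mem_reach (T : IET A d) {p n : ℕ} (a : A) (h : p ≤ n)
    (hw : winner (rauzy^[n] T) ∈ T.reach p a n) :
    loser (rauzy^[n] T) ∈ T.reach p a (n + 1) := by
  rw [mem_reach] at hw ⊢
  rw [cocycle_succ_apply T h, if_pos rfl]
  exact add_pos_of_nonneg_of_pos (T.cocycle_nonneg h _ _) hw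

/-- If all letters win twice in a row, a row of the cocycle gains a positive entry. When the winner
passes from the complement of the set `S` of letters reached so far into `S`, the former winner,
still in last position of its row, is the loser of the next step, and so it is reached. -/
theorem card_reach_lt (T : IET A d) {p x y z : ℕ} (a : A) (hpx : p ≤ x) (hxy : x ≤ y)
    (hyz : y ≤ z) (h1 : T.names x y = Finset.univ) (h2 : T.names y z = Finset.univ)
    (hne : T.reach p a x ≠ Finset.univ) : (T.reach p a x).card < (T.reach p a z).card := by
  by_contra hcon
  have hz : T.reach p a x = T.reach p a z :=
    Finset.eq_of_subset_of_card_le (T.reach_mono a hpx (hxy.trans hyz)) (not_lt.1 hcon)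
  have hconst : ∀ n, x ≤ n → n ≤ z → T.reach p a n = T.reach p a x := fun n hn hn' =>
    ((T.reach_mono a (hpx.trans hn) hn').trans hz.ge).antisymm (T.reach_mono a hpx hn)
  obtain ⟨b, hb⟩ : ∃ b, b ∉ T.reach p a x := by
    by_contra! h
    exact hne (Finset.eq_univ_iff_forall.2 h)
  have ha : a ∈ T.reach p a x := mem_reach.2 (T.one_le_cocycle_diag hpx a)
  obtain ⟨n₁, hn₁, hb₁⟩ := Finset.mem_image.1 (h1.ge (Finset.mem_univ b))
  obtain ⟨n₂, hn₂, ha₂⟩ := Finset.mem_image.1 (h2.ge (Finset.mem_univ a))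
  rw [Finset.mem_Ico] at hn₁ hn₂
  have hstep : ∀ n, n₁ ≤ n → n ≤ n₂ → winner (rauzy^[n] T) ∉ T.reach p a x := by
    intro n hn
    induction n, hn using Nat.le_induction with
    | base => exact fun _ => hb₁ ▸ hb
    | succ n hn ih =>
      intro hn' hmem
      have hnot := ih (by omega)
      have hlos : loser (rauzy^[n + 1] T) = winner (rauzy^[n] T) := by
        rw [Function.iterate_succ_apply'] at hmem ⊢
        exact loser_rauzy_of_winner_ne _ fun h => hnot (h ▸ hmem)
      rw [← hconst (n + 1) (by omega) (by omega)] at hmem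
      have := T.loser_mem_reach a (by omega) hmem
      rw [hconst (n + 1 + 1) (by omega) (by omega), hlos] at this
      exact hnot this
  exact hstep n₂ (by omega) le_rfl (ha₂ ▸ ha)

theorem names_mono (T : IET A d) {n n' m m' : ℕ} (h : m ≤ n) (h' : n' ≤ m') :
    T.names n n' ⊆ T.names m m' :=
  Finset.image_subset_image (Finset.Ico_subset_Ico h h')

theorem IsAcceleration.monotone {T : IET A d} {D : ℕ} {m : ℕ → ℕ} (hm : T.IsAcceleration D m) :
    Monotone m := monotone_nat_of_le_succ fun k => (hm.2 k).1.1

/-- By maximality of `m (k + 1)`, all letters win up to the time `m (k + 1) + 1`. -/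
theorem IsAcceleration.names_eq_univ {T : IET A d} (hd : 2 ≤ d) {m : ℕ → ℕ}
    (hm : T.IsAcceleration (d - 1) m) (k : ℕ) : T.names (m k) (m (k + 2)) = Finset.univ := by
  have h1 : m (k + 1) + 1 ≤ m (k + 2) := by
    refine (hm.2 (k + 1)).2 ⟨Nat.le_succ _, ?_⟩
    simp only [names, Nat.Ico_succ_singleton, Finset.image_singleton, Finset.card_singleton]
    omega
  refine Finset.eq_univ_iff_forall.2 fun a => T.names_mono le_rfl h1 ?_
  have h2 : ¬ (T.names (m k) (m (k + 1) + 1)).card ≤ d - 1 := fun h =>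
    absurd ((hm.2 k).2 ⟨(hm.2 k).1.1.trans (Nat.le_succ _), h⟩) (by omega)
  have h3 : T.names (m k) (m (k + 1) + 1) = Finset.univ := by
    refine Finset.eq_univ_of_card _ (le_antisymm (Finset.card_le_univ _) ?_)
    rw [T.card_eq]
    omega
  rw [h3]
  exact Finset.mem_univ a

theorem IsAcceleration.le_card_reach {T : IET A d} (hd : 2 ≤ d) {m : ℕ → ℕ}
    (hm : T.IsAcceleration (d - 1) m) (k j : ℕ) (a : A) :
    min d (j + 1) ≤ (T.reach (m k) a (m (k + 4 * j))).card := by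
  induction j with
  | zero =>
    refine (min_le_right _ _).trans (Finset.card_pos.2 ⟨a, mem_reach.2 ?_⟩)
    exact T.one_le_cocycle_diag le_rfl a
  | succ j ih =>
    have hx : m k ≤ m (k + 4 * j) := hm.monotone (by omega)
    have hz : m (k + 4 * j) ≤ m (k + 4 * (j + 1)) := hm.monotone (by omega)
    by_cases hne : T.reach (m k) a (m (k + 4 * j)) = Finset.univ
    · have := Finset.card_le_card (T.reach_mono a hx hz)
      rw [hne, Finset.card_univ, T.card_eq] at this
      exact (min_le_left _ _).trans this
    · have := T.card_reach_lt a hx (hm.monotone (by omega : k + 4 * j ≤ k + 4 * j + 2))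
        (hm.monotone (by omega : k + 4 * j + 2 ≤ k + 4 * (j + 1)))
        (hm.names_eq_univ hd _) (hm.names_eq_univ hd _) hne
      omega

theorem IsAcceleration.cocycle_pos {T : IET A d} (hd : 2 ≤ d) {m : ℕ → ℕ}
    (hm : T.IsAcceleration (d - 1) m) (k : ℕ) (a b : A) :
    0 < T.cocycle (m k) (m (k + 4 * d)) a b := by
  have h1 := hm.le_card_reach hd k d a
  rw [min_eq_left (Nat.le_succ d)] at h1
  have h2 : T.reach (m k) a (m (k + 4 * d)) = Finset.univ :=
    Finset.eq_univ_of_card _ (le_antisymm (Finset.card_le_univ _) (T.card_eq.trans_le h1))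
  rw [← mem_reach, h2]
  exact Finset.mem_univ b

/-- A sequence of times between which the cocycle is positive and bounded. -/
structure IsBoundedPositive (T : IET A d) (q : ℕ → ℕ) (M : ℝ) : Prop where
  zero : q 0 = 0
  mono : Monotone q
  one_le : ∀ k a b, 1 ≤ T.cocycle (q k) (q (k + 1)) a b
  le : ∀ k a b, (T.cocycle (q k) (q (k + 1)) a b : ℝ) ≤ M

theorem cocycle_le_pow {T : IET A d} {m : ℕ → ℕ} (hm : Monotone m) {C : ℝ} (hC0 : 0 < C)
    (hC : ∀ k a b, |(T.cocycle (m k) (m (k + 1)) a b : ℝ)| ≤ C) (k j : ℕ) (a b : A) :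
    (T.cocycle (m k) (m (k + j)) a b : ℝ) ≤ (d * C) ^ j := by
  induction j generalizing b with
  | zero =>
    rw [add_zero, cocycle_self, Matrix.one_apply]
    split_ifs <;> simp
  | succ j ih =>
    rw [← add_assoc, ← T.cocycle_mul (hm (Nat.le_add_right k j)) (hm (Nat.le_succ (k + j))),
      Matrix.mul_apply]
    push_cast
    calc _ ≤ ∑ _c : A, (d * C) ^ j * C := by
          refine Finset.sum_le_sum fun c _ => mul_le_mul (ih c)
            ((le_abs_self _).trans (hC _ _ _)) ?_ (by positivity)
          exact_mod_cast T.cocycle_nonneg (hm (Nat.le_succ (k + j))) c b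
      _ = (d * C) ^ (j + 1) := by
          rw [Finset.sum_const, Finset.card_univ, T.card_eq, nsmul_eq_mul]
          ring

theorem IsBoundedType.exists_isBoundedPositive {T : IET A d} (hd : 2 ≤ d)
    (hT : T.IsBoundedType) : ∃ q M, T.IsBoundedPositive q M := by
  obtain ⟨m, hm, C, hC0, hC⟩ := hT
  have hm0 := hm.1
  refine ⟨fun k => m (4 * d * k), (d * C) ^ (4 * d), by simpa using hm0,
    fun i j hij => hm.monotone (by gcongr), fun k a b => ?_, fun k a b => ?_⟩
  · exact hm.cocycle_pos hd _ a b
  · exact cocycle_le_pow hm.monotone hC0 hC _ _ a b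

/-! ### Lengths and heights along a positive bounded cocycle -/

/-- The sum of the heights of the towers at time `n`. -/
def heightSum (T : IET A d) (n : ℕ) : ℕ := ∑ a, T.height n a

theorem height_le_heightSum (T : IET A d) (n : ℕ) (a : A) : T.height n a ≤ T.heightSum n :=
  Finset.single_le_sum (fun _ _ => Nat.zero_le _) (Finset.mem_univ a)

namespace IsBoundedPositive

variable {T : IET A d} {q : ℕ → ℕ} {M : ℝ}

theorem heightSum_le_height (hq : T.IsBoundedPositive q M) (k : ℕ) (b : A) :
    T.heightSum (q k) ≤ T.height (q (k + 1)) b := by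
  have h : (T.heightSum (q k) : ℤ) ≤ T.height (q (k + 1)) b := by
    rw [T.height_eq_sum (hq.mono (Nat.le_succ k)), heightSum, Nat.cast_sum]
    exact Finset.sum_le_sum fun a _ =>
      le_mul_of_one_le_right (Int.natCast_nonneg _) (hq.one_le k a b)
  exact_mod_cast h

theorem one_le_bound (hq : T.IsBoundedPositive q M) : 1 ≤ M := by
  obtain ⟨a, -⟩ := T.exists_perm_eq_zero false
  exact le_trans (by exact_mod_cast hq.one_le 0 a a) (hq.le 0 a a)

theorem heightSum_succ_le (hq : T.IsBoundedPositive q M) (k : ℕ) :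
    (T.heightSum (q (k + 1)) : ℝ) ≤ d * M * T.heightSum (q k) := by
  have h : ∀ b, (T.height (q (k + 1)) b : ℝ) ≤ M * T.heightSum (q k) := by
    intro b
    have h1 : (T.height (q (k + 1)) b : ℝ) =
        ∑ a, (T.height (q k) a : ℝ) * T.cocycle (q k) (q (k + 1)) a b := by
      exact_mod_cast T.height_eq_sum (hq.mono (Nat.le_succ k)) b
    rw [h1, heightSum, Nat.cast_sum, Finset.mul_sum]
    refine Finset.sum_le_sum fun a _ => ?_
    rw [mul_comm]
    gcongr
    exact hq.le k a b
  calc (T.heightSum (q (k + 1)) : ℝ) = ∑ b, (T.height (q (k + 1)) b : ℝ) := by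
        rw [heightSum, Nat.cast_sum]
    _ ≤ ∑ _b : A, M * T.heightSum (q k) := Finset.sum_le_sum fun b _ => h b
    _ = d * M * T.heightSum (q k) := by
        rw [Finset.sum_const, Finset.card_univ, T.card_eq, nsmul_eq_mul, mul_assoc]

theorem heightSum_zero (hq : T.IsBoundedPositive q M) : T.heightSum (q 0) = d := by
  simp [heightSum, hq.zero, height, T.card_eq]

theorem lt_heightSum (hq : T.IsBoundedPositive q M) (hd : 2 ≤ d) (k : ℕ) :
    k < T.heightSum (q k) := by
  induction k with
  | zero => rw [hq.heightSum_zero]; omega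
  | succ k ih =>
    have h : d * T.heightSum (q k) ≤ T.heightSum (q (k + 1)) := by
      rw [heightSum.eq_def _ (q (k + 1))]
      calc d * T.heightSum (q k) = ∑ _b : A, T.heightSum (q k) := by
            rw [Finset.sum_const, Finset.card_univ, T.card_eq, smul_eq_mul]
        _ ≤ _ := Finset.sum_le_sum fun b _ => hq.heightSum_le_height k b
    nlinarith

theorem total_le_len (hq : T.IsBoundedPositive q M) (hd : 2 ≤ d) (hirr : T.IsIrreducible)
    (hK : T.Keane) (k : ℕ) (a : A) :
    (rauzy^[q (k + 1)] T).total ≤ (rauzy^[q k] T).len a := by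
  rw [len_eq_sum hd hirr hK (hq.mono (Nat.le_succ k)) a, total]
  exact Finset.sum_le_sum fun b _ => le_mul_of_one_le_left (len_pos _ b).le
    (by exact_mod_cast hq.one_le k a b)

theorem len_le_mul_len (hq : T.IsBoundedPositive q M) (hd : 2 ≤ d) (hirr : T.IsIrreducible)
    (hK : T.Keane) (k : ℕ) (a b : A) :
    (rauzy^[q k] T).len a ≤ M * (rauzy^[q k] T).len b := by
  have hM := hq.one_le_bound
  calc (rauzy^[q k] T).len a ≤ M * (rauzy^[q (k + 1)] T).total := by
        rw [len_eq_sum hd hirr hK (hq.mono (Nat.le_succ k)) a, total, Finset.mul_sum]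
        exact Finset.sum_le_sum fun b _ =>
          mul_le_mul_of_nonneg_right (hq.le k a b) (len_pos _ b).le
    _ ≤ _ := by
        gcongr
        exact hq.total_le_len hd hirr hK k b

theorem total_le_mul_len (hq : T.IsBoundedPositive q M) (hd : 2 ≤ d) (hirr : T.IsIrreducible)
    (hK : T.Keane) (k : ℕ) (a : A) :
    T.total ≤ M * T.heightSum (q k) * (rauzy^[q k] T).len a := by
  rw [← sum_height_mul_len hd hirr hK (q k), heightSum, Nat.cast_sum, Finset.mul_sum,
    Finset.sum_mul]
  refine Finset.sum_le_sum fun b _ => ?_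
  calc _ ≤ (T.height (q k) b : ℝ) * (M * (rauzy^[q k] T).len a) := by
        gcongr
        exact hq.len_le_mul_len hd hirr hK k b a
    _ = _ := by ring

theorem heightSum_mul_len_le (hq : T.IsBoundedPositive q M) (hd : 2 ≤ d)
    (hirr : T.IsIrreducible) (hK : T.Keane) (k : ℕ) (a : A) :
    T.heightSum (q k) * (rauzy^[q k] T).len a ≤ M * T.total := by
  rw [← sum_height_mul_len hd hirr hK (q k), heightSum, Nat.cast_sum, Finset.mul_sum,
    Finset.sum_mul]
  refine Finset.sum_le_sum fun b _ => ?_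
  calc _ ≤ (T.height (q k) b : ℝ) * (M * (rauzy^[q k] T).len b) := by
        gcongr
        exact hq.len_le_mul_len hd hirr hK k a b
    _ = _ := by ring

end IsBoundedPositive

/-! ### Floors of towers: separation -/

theorem eq_of_left_mem_cell {R : IET A d} {a b : A} (h : R.left false b ∈ R.cell a) : a = b := by
  rcases lt_trichotomy (R.perm false a : ℕ) (R.perm false b) with hlt | heq | hlt
  · exact absurd h.2 (R.left_add_len_le_left false hlt).not_gt
  · exact (R.perm false).injective (Fin.ext heq)
  · have h1 := R.left_add_len_le_left false hlt
    have h2 := R.len_pos b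
    have h3 := h.1
    linarith

namespace IsTower

variable {T R R' : IET A d} {h h' : A → ℕ}

theorem exists_left (H : IsTower T R h) (a : A) :
    ∃ x : Set.Ico (0 : ℝ) T.total, (x : ℝ) = R.left false a :=
  ⟨⟨_, mem_Ico_of_mem_cell R H.total_le (R.left_mem_cell a)⟩, rfl⟩

theorem eq_of_map_pow_eq_of_le (H : IsTower T R h) {b : A} {s t : ℕ}
    {x y : Set.Ico (0 : ℝ) T.total} (hx : (x : ℝ) < R.total) (hy : (y : ℝ) ∈ R.cell b)
    (hst : s ≤ t) (ht : t < h b) (hxy : (T.map ^ s) x = (T.map ^ t) y) : x = y := by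
  rw [show t = s + (t - s) by omega, ← map_pow_add] at hxy
  have h1 := (T.map ^ s).injective hxy
  rcases Nat.eq_zero_or_pos (t - s) with h0 | h0
  · rwa [h0, pow_zero, Equiv.Perm.one_apply] at h1
  · have h2 := H.le_map b y hy (t - s) h0 (by omega)
    rw [← h1] at h2
    exact absurd hx h2.not_gt

/-- Different floors of the towers are disjoint. -/
theorem eq_of_map_pow_eq (H : IsTower T R h) {a b : A} {s t : ℕ}
    {x y : Set.Ico (0 : ℝ) T.total} (hx : (x : ℝ) ∈ R.cell a) (hy : (y : ℝ) ∈ R.cell b)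
    (hs : s < h a) (ht : t < h b) (hxy : (T.map ^ s) x = (T.map ^ t) y) : x = y := by
  rcases le_total s t with hst | hst
  · exact H.eq_of_map_pow_eq_of_le (R.lt_total_of_mem_cell hx) hy hst ht hxy
  · exact (H.eq_of_map_pow_eq_of_le (R.lt_total_of_mem_cell hy) hx hst hs hxy.symm).symm

/-- The left endpoints of the floors of the towers. -/
def floorEnds (T R : IET A d) (h : A → ℕ) : Set ℝ :=
  {z | ∃ a, ∃ s < h a, ∃ x : Set.Ico (0 : ℝ) T.total,
    (x : ℝ) = R.left false a ∧ ((T.map ^ s) x : ℝ) = z}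

theorem exists_mem_floor (H : IsTower T R h) {a : A} {s : ℕ} (hs : s < h a)
    {x : Set.Ico (0 : ℝ) T.total} (hx : (x : ℝ) = R.left false a) {z : ℝ}
    (hz : ((T.map ^ s) x : ℝ) ≤ z) (hz' : z < (T.map ^ s) x + R.len a) :
    ∃ y : Set.Ico (0 : ℝ) T.total, (y : ℝ) ∈ R.cell a ∧ (y : ℝ) = x + (z - (T.map ^ s) x) ∧
      ((T.map ^ s) y : ℝ) = z := by
  obtain ⟨τ, hτ⟩ := H.translate a s hs.le
  have hxa : (x : ℝ) ∈ R.cell a := by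
    rw [hx]
    exact R.left_mem_cell a
  have hya : (x : ℝ) + (z - (T.map ^ s) x) ∈ R.cell a := by
    rw [hx]
    constructor <;> linarith
  refine ⟨⟨_, mem_Ico_of_mem_cell R H.total_le hya⟩, hya, rfl, ?_⟩
  have h1 := hτ ⟨_, mem_Ico_of_mem_cell R H.total_le hya⟩ hya
  have h2 := hτ x hxa
  simp only at h1
  linarith

/-- Floors are disjoint, so their left endpoints are separated by the lengths of the floors. -/
theorem separation (H : IsTower T R h) {δ : ℝ} (hδ : ∀ a, δ ≤ R.len a) {z z' : ℝ}
    (hz : z ∈ floorEnds T R h ∪ {0, T.total}) (hz' : z' ∈ floorEnds T R h ∪ {0, T.total})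
    (hlt : z < z') : δ ≤ z' - z := by
  have hzero : (0 : ℝ) ∈ floorEnds T R h := by
    obtain ⟨a, ha⟩ := R.exists_perm_eq_zero false
    obtain ⟨x, hx⟩ := H.exists_left a
    exact ⟨a, 0, H.pos a, x, hx, by simp [hx, R.left_eq_zero ha]⟩
  have hle : z' ≤ T.total := by
    rcases hz' with ⟨a, s, hs, x, hx, rfl⟩ | rfl | rfl
    · exact (Subtype.prop ((T.map ^ s) x)).2.le
    · exact T.total_pos.le
    · exact le_rfl
  have hzE : z ∈ floorEnds T R h := by
    rcases hz with hz | rfl | rfl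
    · exact hz
    · exact hzero
    · exact absurd hlt hle.not_gt
  obtain ⟨a, s, hs, x, hx, rfl⟩ := hzE
  refine (hδ a).trans ?_
  by_contra hcon
  obtain ⟨y, hya, hy, hyz⟩ := H.exists_mem_floor hs hx hlt.le (by linarith)
  have hz'E : z' ∈ floorEnds T R h := by
    rcases hz' with hz' | rfl | rfl
    · exact hz'
    · exact hzero
    · exact absurd hyz (Subtype.prop ((T.map ^ s) y)).2.ne
  obtain ⟨b, t, ht, x', hx', hxz'⟩ := hz'E
  have hx'b : (x' : ℝ) ∈ R.cell b := by
    rw [hx']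
    exact R.left_mem_cell b
  have hyx' := H.eq_of_map_pow_eq hya hx'b hs ht (Subtype.ext (hyz.trans hxz'.symm))
  subst hyx'
  obtain rfl := eq_of_left_mem_cell (hx' ▸ hya)
  linarith

/-- If the base of the towers shrinks below the lengths of all intervals, then the floor
containing `ℓ_a` moves up and away from both ends of its tower, unless `a` is the first letter of
the respective row. -/
theorem anchor_deep (H : IsTower T R h) (H' : IsTower T R' h')
    (hlen : ∀ a, R'.total ≤ R.len a) {N : ℕ} (hN : ∀ a, N ≤ h a) (a : A) :
    ∃ s < h' a, (∃ x : Set.Ico (0 : ℝ) T.total,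
      (x : ℝ) = R'.left false a ∧ (T.map ^ s) x = T.leftPt a) ∧
      ((T.perm false a : ℕ) ≠ 0 → N ≤ s) ∧ ((T.perm true a : ℕ) ≠ 0 → N + s < h' a) := by
  obtain ⟨s, hs, x, hx, hsx⟩ := H.anchor a
  obtain ⟨s', hs', x', hx', hsx'⟩ := H'.anchor a
  have hxa : (x : ℝ) ∈ R.cell a := by
    rw [hx]
    exact R.left_mem_cell a
  have hxa' : (x' : ℝ) ∈ R'.cell a := by
    rw [hx']
    exact R'.left_mem_cell a
  have hle : R'.total ≤ R.total :=
    (hlen a).trans (by linarith [R.left_nonneg false a, R.left_add_len_le false a])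
  have hfar : ∀ ε, (T.perm ε a : ℕ) ≠ 0 → R'.total ≤ R.left ε a := by
    intro ε hε
    obtain ⟨o, ho⟩ := R.exists_perm_eq_zero ε
    rw [Ne, ← H.perm_zero ε] at hε
    have h1 := R.left_add_len_le_left ε (a := o) (b := a) (by omega)
    have h2 := R.left_nonneg ε o
    linarith [hlen o]
  refine ⟨s', hs', ⟨x', hx', hsx'⟩, fun hfirst => ?_, fun hfirst => ?_⟩
  · have hxge := hfar false hfirst
    have hxlt' := R'.lt_total_of_mem_cell hxa'
    rcases lt_trichotomy s s' with hlt | rfl | hlt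
    · obtain ⟨b, hb⟩ := R.exists_mem_cell x'.2.1 (hxlt'.trans_le hle)
      have h1 : (T.map ^ (s' - s)) x' = x := by
        apply (T.map ^ s).injective
        rw [map_pow_add, Nat.add_sub_cancel' hlt.le, hsx, hsx']
      have h2 := H.height_le hb (Nat.sub_pos_of_lt hlt)
        (by rw [h1]; exact R.lt_total_of_mem_cell hxa)
      have := hN b
      omega
    · have h1 := (T.map ^ s).injective (hsx.trans hsx'.symm)
      rw [← h1] at hxlt'
      linarith
    · have h1 : (T.map ^ (s - s')) x = x' := by
        apply (T.map ^ s').injective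
        rw [map_pow_add, Nat.add_sub_cancel' hlt.le, hsx, hsx']
      have h2 := H.height_le hxa (Nat.sub_pos_of_lt hlt) (by rw [h1]; linarith)
      omega
  · have hy : ((T.map ^ h a) x : ℝ) = R.left true a := by
      rw [H.ret a x hxa, hx, jump]
      ring
    have hy' : ((T.map ^ h' a) x' : ℝ) = R'.left true a := by
      rw [H'.ret a x' hxa', hx', jump]
      ring
    have hyge := hfar true hfirst
    have hylt' := R'.left_lt_total true a
    have e : (T.map ^ (h a - s)) (T.leftPt a) = (T.map ^ h a) x := by
      rw [← hsx, map_pow_add, Nat.sub_add_cancel hs.le]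
    have e' : (T.map ^ (h' a - s')) (T.leftPt a) = (T.map ^ h' a) x' := by
      rw [← hsx', map_pow_add, Nat.sub_add_cancel hs'.le]
    rcases lt_trichotomy (h a - s) (h' a - s') with hlt | heq | hlt
    · have h1 : (T.map ^ (h' a - s' - (h a - s))) ((T.map ^ h a) x) = (T.map ^ h' a) x' := by
        rw [← e, ← e', map_pow_add, Nat.sub_add_cancel hlt.le]
      obtain ⟨b, hb⟩ := R.exists_mem_cell (x := ((T.map ^ h a) x : ℝ))
        (Subtype.prop ((T.map ^ h a) x)).1 (by rw [hy]; exact R.left_lt_total true a)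
      have h2 := H.height_le hb (Nat.sub_pos_of_lt hlt) (by rw [h1, hy']; linarith)
      have := hN b
      omega
    · rw [heq, e'] at e
      rw [e, hy] at hy'
      linarith
    · have h1 : (T.map ^ (h a - (h a - s - (h' a - s')))) x = (T.map ^ h' a) x' := by
        apply (T.map ^ (h a - s - (h' a - s'))).injective
        rw [map_pow_add, Nat.add_sub_cancel' (by omega), ← e, ← e', map_pow_add,
          Nat.sub_add_cancel hlt.le]
      have h2 := H.le_map a x hxa (h a - (h a - s - (h' a - s'))) (by omega) (by omega)
      rw [h1, hy'] at h2
      linarith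

/-- The orbits of the `ℓ_a` up to time `N` consist of left endpoints of floors. Where `ℓ_a` lies at an
end of its tower, the orbit continues through `T ℓ_b = 0`, with `b` the first letter of the bottom
row. -/
theorem zpow_mem_floorEnds (H : IsTower T R h) (H' : IsTower T R' h') (hd : 2 ≤ d)
    (hirr : T.IsIrreducible) (hlen : ∀ a, R'.total ≤ R.len a) {N : ℕ} (hN : ∀ a, N ≤ h a)
    (hN' : ∀ a, N ≤ h' a) {i : ℤ} (hi : |i| ≤ N) (a : A) :
    ((T.map ^ i) (T.leftPt a) : ℝ) ∈ floorEnds T R' h' := by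
  rw [abs_le] at hi
  obtain ⟨o, ho⟩ := T.exists_perm_eq_zero false
  obtain ⟨b, hb⟩ := T.exists_perm_eq_zero true
  have key : ∀ a, ∀ i : ℤ, ∀ s : ℕ, ∀ x : Set.Ico (0 : ℝ) T.total,
      (x : ℝ) = R'.left false a → (T.map ^ s) x = T.leftPt a → 0 ≤ i + s → i + s < h' a →
      ((T.map ^ i) (T.leftPt a) : ℝ) ∈ floorEnds T R' h' := by
    intro a i s x hx hsx h0 h1
    refine ⟨a, (i + s).toNat, by omega, x, hx, ?_⟩
    rw [← hsx, ← zpow_natCast, ← zpow_natCast, map_zpow_add, Int.toNat_of_nonneg h0]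
  have hfirst : ∀ j : ℤ, (T.map ^ j) (T.leftPt o) = (T.map ^ (j + 1)) (T.leftPt b) := by
    intro j
    rw [← T.map_leftPt_of_perm_zero ho hb, ← map_zpow_add, zpow_one]
  obtain ⟨s, hs, ⟨x, hx, hsx⟩, hs1, hs2⟩ := H.anchor_deep H' hlen hN a
  rcases lt_trichotomy i 0 with hi0 | rfl | hi0
  · by_cases ha : (T.perm false a : ℕ) = 0
    · obtain rfl : a = o := (T.perm false).injective (Fin.ext (ha.trans ho.symm))
      obtain ⟨t, ht, ⟨y, hy, hty⟩, ht1, -⟩ := H.anchor_deep H' hlen hN b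
      have := ht1 (hirr.perm_false_ne_zero hd hb)
      rw [hfirst]
      exact key b (i + 1) t y hy hty (by omega) (by omega)
    · have := hs1 ha
      exact key a i s x hx hsx (by omega) (by omega)
  · exact key a 0 s x hx hsx (by omega) (by omega)
  · by_cases ha : (T.perm true a : ℕ) = 0
    · obtain rfl : a = b := (T.perm true).injective (Fin.ext (ha.trans hb.symm))
      -- Here `T ℓ_a = 0`, and the orbit goes on in the tower of the first letter.
      have := hN' o
      have h1 : (T.map ^ i) (T.leftPt a) = (T.map ^ (i - 1)) (T.leftPt o) := by
        rw [hfirst, sub_add_cancel]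
      rw [h1]
      refine key o (i - 1) 0 (T.leftPt o) ?_ rfl (by omega) (by omega)
      exact (T.left_eq_zero ho).trans (R'.left_eq_zero ((H'.perm_zero false o).2 ho)).symm
    · have := hs2 ha
      exact key a i s x hx hsx (by omega) (by omega)

theorem ret_lt_total (H : IsTower T R h) {a : A} {x : Set.Ico (0 : ℝ) T.total}
    (hx : (x : ℝ) ∈ R.cell a) : ((T.map ^ h a) x : ℝ) < R.total := by
  rw [H.ret a x hx, jump]
  linarith [hx.2, R.left_add_len_le true a]

end IsTower

/-! ### Floors of towers: density -/

/-- A positive entry `(a, b)` of the cocycle means that the later tower with label `b` runs through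
the earlier tower with label `a`. -/
theorem exists_visit {T : IET A d} (hd : 2 ≤ d) (hirr : T.IsIrreducible) (hK : T.Keane)
    {n n' : ℕ} (h : n ≤ n') (a b : A) (hB : 0 < T.cocycle n n' a b) :
    ∃ s < T.height n' b, ∀ x : Set.Ico (0 : ℝ) T.total, (x : ℝ) ∈ (rauzy^[n'] T).cell b →
      ((T.map ^ s) x : ℝ) ∈ (rauzy^[n] T).cell a := by
  induction n', h using Nat.le_induction generalizing b with
  | base =>
    rw [cocycle_self, Matrix.one_apply] at hB
    obtain rfl : a = b := by
      by_contra hab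
      simp [hab] at hB
    exact ⟨0, (isTower_height hd hirr hK n).1.pos a, fun x hx => by simpa using hx⟩
  | succ k hk ih =>
    have H := (isTower_height hd hirr hK k).1
    have S := isStep_rauzy (len_loser_lt_len_winner hd hirr hK k)
    rw [cocycle_succ_apply T hk] at hB
    rw [Function.iterate_succ_apply']
    simp only [height]
    by_cases hb : b = loser (rauzy^[k] T)
    · rw [if_pos hb] at hB ⊢
      subst hb
      have hB' : 0 < T.cocycle n k a (loser (rauzy^[k] T)) ∨
          0 < T.cocycle n k a (winner (rauzy^[k] T)) := by
        by_contra! hcon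
        omega
      -- The new tower consists of the towers `p` and `q`, in this order.
      have key : ∀ p q, T.height k (loser (rauzy^[k] T)) + T.height k (winner (rauzy^[k] T)) =
          T.height k p + T.height k q →
          IsStep (rauzy^[k] T) (rauzy (rauzy^[k] T)) (loser (rauzy^[k] T)) p q →
          0 < T.cocycle n k a p ∨ 0 < T.cocycle n k a q →
          ∃ s < T.height k (loser (rauzy^[k] T)) + T.height k (winner (rauzy^[k] T)),
            ∀ x : Set.Ico (0 : ℝ) T.total,
            (x : ℝ) ∈ (rauzy (rauzy^[k] T)).cell (loser (rauzy^[k] T)) →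
            ((T.map ^ s) x : ℝ) ∈ (rauzy^[n] T).cell a := by
        intro p q hpq S hpos
        rw [hpq]
        rcases hpos with hpos | hpos
        · obtain ⟨s, hs, hv⟩ := ih p hpos
          exact ⟨s, by omega, fun x hx => hv x (S.cell_loser_subset hx)⟩
        · obtain ⟨s, hs, hv⟩ := ih q hpos
          refine ⟨s + T.height k p, by omega, fun x hx => ?_⟩
          rw [← map_pow_add]
          refine hv _ ?_
          rw [H.ret p x (S.cell_loser_subset hx)]
          exact (S.add_jump_mem x hx).1
      cases ht : type (rauzy^[k] T)
      · rw [ht] at S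
        exact key _ _ rfl S hB'
      · rw [ht] at S
        exact key _ _ (add_comm _ _) S hB'.symm
    · rw [if_neg hb, add_zero] at hB ⊢
      obtain ⟨s, hs, hv⟩ := ih b hB
      exact ⟨s, hs, fun x hx => hv x (S.cell_subset b hb hx)⟩

namespace IsBoundedPositive

variable {T : IET A d} {q : ℕ → ℕ} {M : ℝ}

/-- Every orbit segment of length `3 σ_{k+1}` meets every floor of the towers at time `q_k`: it climbs
to the top of its tower at time `q_{k+1}`, and the next such tower runs through all earlier ones. -/
theorem exists_map_pow_eq (hq : T.IsBoundedPositive q M) (hd : 2 ≤ d) (hirr : T.IsIrreducible)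
    (hK : T.Keane) (k : ℕ) (y : Set.Ico (0 : ℝ) T.total) {a : A} {u : ℕ}
    (hu : u < T.height (q k) a) :
    ∃ i ≤ 3 * T.heightSum (q (k + 1)), ∃ x : Set.Ico (0 : ℝ) T.total,
      (x : ℝ) ∈ (rauzy^[q k] T).cell a ∧ (T.map ^ i) y = (T.map ^ u) x := by
  have H := (isTower_height hd hirr hK (q (k + 1))).1
  obtain ⟨b, s, hs, x, hx, rfl⟩ := H.cover y
  obtain ⟨c, hc⟩ := IET.exists_mem_cell (rauzy^[q (k + 1)] T)
    (Subtype.prop ((T.map ^ T.height (q (k + 1)) b) x)).1 (H.ret_lt_total hx)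
  obtain ⟨t, ht, hv⟩ := exists_visit hd hirr hK (hq.mono (Nat.le_add_right k 1)) a c
    (hq.one_le k a c)
  have h1 := T.height_le_heightSum (q (k + 1)) b
  have h2 := T.height_le_heightSum (q (k + 1)) c
  have h3 := T.height_le_heightSum (q k) a
  have h4 := hq.heightSum_le_height k c
  refine ⟨u + (t + (T.height (q (k + 1)) b - s)), by omega, _, hv _ hc, ?_⟩
  simp only [map_pow_add]
  congr 2
  omega

/-- An interval of length more than `2 η` contains the floor through its midpoint, and every orbit
meets that floor. -/
theorem exists_map_pow_mem_Ioo (hq : T.IsBoundedPositive q M) (hd : 2 ≤ d)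
    (hirr : T.IsIrreducible) (hK : T.Keane) (k : ℕ) (z : Set.Ico (0 : ℝ) T.total) {η x y : ℝ}
    (hη : ∀ a, (rauzy^[q k] T).len a ≤ η) (hx : 0 ≤ x) (hy : y ≤ T.total)
    (hxy : 2 * η < y - x) :
    ∃ i ≤ 3 * T.heightSum (q (k + 1)), x < (T.map ^ i) z ∧ ((T.map ^ i) z : ℝ) < y := by
  have H := (isTower_height hd hirr hK (q k)).1
  have hη0 : 0 < η := by
    obtain ⟨a, -⟩ := T.exists_perm_eq_zero false
    exact (len_pos _ a).trans_le (hη a)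
  obtain ⟨a, u, hu, x₀, hx₀, hmid⟩ := H.cover ⟨(x + y) / 2, by linarith, by linarith⟩
  obtain ⟨i, hi, x₁, hx₁, hix⟩ := hq.exists_map_pow_eq hd hirr hK k z hu
  obtain ⟨τ, hτ⟩ := H.translate a u hu.le
  refine ⟨i, hi, ?_⟩
  have h0 := hτ x₀ hx₀
  rw [hmid] at h0
  rw [hix, hτ x₁ hx₁]
  have h1 := hη a
  simp only at h0
  constructor <;> linarith [hx₀.1, hx₀.2, hx₁.1, hx₁.2]

/-- The density of `n` consecutive points of the orbit of `ℓ_a`, with gaps of order `1 / n`: the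
level `k` is chosen with `σ_k` of order `n`. -/
theorem exists_preimage_mem_Ioo (hq : T.IsBoundedPositive q M) (hd : 2 ≤ d)
    (hirr : T.IsIrreducible) (hK : T.Keane) (a : A) {n j : ℕ} (hj : j < n) {x y : ℝ} (hx : 0 ≤ x)
    (hy : y ≤ T.total) (hxy : 12 * (d * M) ^ 2 * M * T.total / n < y - x) :
    ∃ z ∈ T.preimages a n j, x < z ∧ z < y := by
  have hM := hq.one_le_bound
  have hL := T.total_pos
  have hn : (0 : ℝ) < n := by exact_mod_cast (Nat.zero_le j).trans_lt hj
  have hd' : (d : ℝ) ≤ d * M := le_mul_of_one_le_right (Nat.cast_nonneg d) hM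
  have hd1 : (1 : ℝ) ≤ d * M := le_trans (by exact_mod_cast T.one_le) hd'
  have hstep : ∀ k, (T.heightSum (q (k + 1)) : ℝ) ≤ d * M * T.heightSum (q k) :=
    hq.heightSum_succ_le
  -- For small `n` the hypothesis on the length of the interval cannot hold.
  have hlarge : 6 * T.heightSum (q 1) < n := by
    by_contra hcon
    have h1 : (n : ℝ) ≤ 6 * T.heightSum (q 1) := by exact_mod_cast not_lt.1 hcon
    have h2 := hstep 0
    rw [hq.heightSum_zero] at h2
    have h3 : (n : ℝ) ≤ 12 * (d * M) ^ 2 * M := by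
      calc (n : ℝ) ≤ 6 * (d * M * (d * M)) := h1.trans (by gcongr; exact h2.trans (by gcongr))
        _ ≤ 12 * (d * M) ^ 2 * 1 := by nlinarith [sq_nonneg (d * M)]
        _ ≤ 12 * (d * M) ^ 2 * M := by gcongr
    have h4 : T.total ≤ 12 * (d * M) ^ 2 * M * T.total / n := by
      rw [le_div_iff₀ hn, mul_comm]
      gcongr
    linarith
  obtain ⟨k, hk1, hk2⟩ : ∃ k, 6 * T.heightSum (q (k + 1)) < n ∧
      n ≤ 6 * T.heightSum (q (k + 2)) := by
    have hex : ∃ k, n ≤ 6 * T.heightSum (q (k + 2)) :=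
      ⟨n, by have := hq.lt_heightSum hd (n + 2); omega⟩
    refine ⟨Nat.find hex, ?_, Nat.find_spec hex⟩
    rcases Nat.eq_zero_or_pos (Nat.find hex) with h0 | h0
    · rwa [h0]
    · have h1 := Nat.find_min hex (Nat.sub_lt h0 one_pos)
      rw [show Nat.find hex - 1 + 2 = Nat.find hex + 1 by omega] at h1
      exact not_le.1 h1
  have hk2' : (n : ℝ) ≤ 6 * ((d * M) ^ 2 * T.heightSum (q k)) := by
    calc (n : ℝ) ≤ 6 * T.heightSum (q (k + 2)) := by exact_mod_cast hk2
      _ ≤ 6 * (d * M * (d * M * T.heightSum (q k))) := by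
          gcongr
          exact (hstep (k + 1)).trans (by gcongr; exact hstep k)
      _ = _ := by ring
  have hη : ∀ a, (rauzy^[q k] T).len a ≤ 6 * (d * M) ^ 2 * M * T.total / n := by
    intro a
    have h1 := hq.heightSum_mul_len_le hd hirr hK k a
    have h2 := len_pos (rauzy^[q k] T) a
    rw [le_div_iff₀ hn]
    calc (rauzy^[q k] T).len a * n
        ≤ (rauzy^[q k] T).len a * (6 * ((d * M) ^ 2 * T.heightSum (q k))) := by gcongr
      _ = 6 * (d * M) ^ 2 * (T.heightSum (q k) * (rauzy^[q k] T).len a) := by ring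
      _ ≤ 6 * (d * M) ^ 2 * (M * T.total) := by gcongr
      _ = _ := by ring
  have hxy' : 2 * (6 * (d * M) ^ 2 * M * T.total / n) < y - x := by
    refine lt_of_eq_of_lt ?_ hxy
    ring
  -- At least half of the orbit segment lies on one side of `ℓ_a`.
  by_cases hjN : 3 * T.heightSum (q (k + 1)) ≤ j
  · obtain ⟨i, hi, hi'⟩ := hq.exists_map_pow_mem_Ioo hd hirr hK k (T.leftPt a) hη hx hy hxy'
    refine ⟨_, T.mem_preimages a (i := i) (by omega) (by omega), ?_⟩
    rwa [zpow_natCast]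
  · obtain ⟨i, hi, hi'⟩ := hq.exists_map_pow_mem_Ioo hd hirr hK k
      ((T.map ^ (-((3 * T.heightSum (q (k + 1)) : ℕ) : ℤ))) (T.leftPt a)) hη hx hy hxy'
    refine ⟨_, T.mem_preimages a (i := i + -((3 * T.heightSum (q (k + 1)) : ℕ) : ℤ))
      (by omega) (by omega), ?_⟩
    rwa [← map_zpow_add, zpow_natCast]

/-- The points `T^i ℓ_a` with `|i| ≤ n` are left endpoints of floors of lengths at least of order
`1 / n`. -/
theorem exists_tower_floorEnds (hq : T.IsBoundedPositive q M) (hd : 2 ≤ d)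
    (hirr : T.IsIrreducible) (hK : T.Keane) {n : ℕ} (hn : 0 < n) :
    ∃ R h, IsTower T R h ∧ (∀ a, T.total / (M * (d * M) ^ 3 * n) ≤ R.len a) ∧
      ∀ i : ℤ, |i| ≤ n → ∀ a, ((T.map ^ i) (T.leftPt a) : ℝ) ∈ IsTower.floorEnds T R h := by
  have hM := hq.one_le_bound
  have hn' : (1 : ℝ) ≤ n := by exact_mod_cast hn
  have hd0 : (0 : ℝ) < d := by exact_mod_cast T.one_le
  have hstep : ∀ k, (T.heightSum (q (k + 1)) : ℝ) ≤ d * M * T.heightSum (q k) :=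
    hq.heightSum_succ_le
  obtain ⟨k, hk1, hk2⟩ : ∃ k, n ≤ T.heightSum (q k) ∧
      (T.heightSum (q k) : ℝ) ≤ d * M * n := by
    have hex : ∃ k, n ≤ T.heightSum (q k) := ⟨n, (hq.lt_heightSum hd n).le⟩
    refine ⟨Nat.find hex, Nat.find_spec hex, ?_⟩
    rcases Nat.eq_zero_or_pos (Nat.find hex) with h0 | h0
    · rw [h0, hq.heightSum_zero, mul_assoc]
      exact le_mul_of_one_le_right hd0.le (one_le_mul_of_one_le_of_one_le hM hn')
    · have h1 := not_le.1 (Nat.find_min hex (Nat.sub_lt h0 one_pos))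
      have h2 := hstep (Nat.find hex - 1)
      rw [Nat.sub_add_cancel h0] at h2
      exact h2.trans (by gcongr)
  have H := (isTower_height hd hirr hK (q (k + 1))).1
  have H' := (isTower_height hd hirr hK (q (k + 2))).1
  have hh : ∀ a, n ≤ T.height (q (k + 1)) a := fun a => hk1.trans (hq.heightSum_le_height k a)
  have hh' : ∀ a, n ≤ T.height (q (k + 2)) a := fun a =>
    ((hh a).trans (T.height_le_heightSum _ a)).trans (hq.heightSum_le_height (k + 1) a)
  refine ⟨_, _, H', fun a => ?_, fun i hi a => H.zpow_mem_floorEnds H' hd hirr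
    (hq.total_le_len hd hirr hK (k + 1)) hh hh' hi a⟩
  rw [div_le_iff₀ (by positivity)]
  have h1 := len_pos (rauzy^[q (k + 2)] T) a
  have h2 : (T.heightSum (q (k + 2)) : ℝ) ≤ (d * M) ^ 3 * n :=
    calc _ ≤ d * M * (d * M * (d * M * n)) := (hstep (k + 1)).trans
          (by gcongr; exact (hstep k).trans (by gcongr))
      _ = _ := by ring
  calc T.total ≤ M * T.heightSum (q (k + 2)) * (rauzy^[q (k + 2)] T).len a :=
        hq.total_le_mul_len hd hirr hK (k + 2) a
    _ ≤ M * ((d * M) ^ 3 * n) * (rauzy^[q (k + 2)] T).len a := by gcongr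
    _ = _ := by ring

end IsBoundedPositive

theorem IsBoundedType.hasBalancedPartitionLengths {T : IET A d} (hd : 2 ≤ d)
    (hirr : T.IsIrreducible) (hK : T.Keane) (hT : T.IsBoundedType) :
    T.HasBalancedPartitionLengths := by
  obtain ⟨q, M, hq⟩ := hT.exists_isBoundedPositive hd
  have hM := hq.one_le_bound
  have hL := T.total_pos
  have hd0 : (0 : ℝ) < d := by exact_mod_cast T.one_le
  have hpos1 : 0 < M * (d * M) ^ 3 / T.total := by positivity
  have hpos2 : 0 < 12 * (d * M) ^ 2 * M * T.total := by positivity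
  refine ⟨M * (d * M) ^ 3 / T.total + 12 * (d * M) ^ 2 * M * T.total, by positivity, ?_⟩
  set c := M * (d * M) ^ 3 / T.total + 12 * (d * M) ^ 2 * M * T.total with hc
  intro n j hj
  have hn0 : 0 < n := by omega
  have hn : (0 : ℝ) < n := by exact_mod_cast hn0
  obtain ⟨R, h, H, hlen, hmem⟩ := hq.exists_tower_floorEnds hd hirr hK hn0
  have hδ : 1 / (c * n) < T.total / (M * (d * M) ^ 3 * n) := by
    rw [div_lt_div_iff₀ (by positivity) (by positivity)]
    have : M * (d * M) ^ 3 < T.total * c := by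
      rw [← div_lt_iff₀' hL]
      linarith
    nlinarith
  have hη : 12 * (d * M) ^ 2 * M * T.total / n < c / n := by
    gcongr
    linarith
  have hsub : ∀ a, T.preimages a n j ⊆ IsTower.floorEnds T R h := by
    rintro a _ ⟨k, hk, rfl⟩
    exact hmem _ (by rw [abs_le]; omega) a
  constructor
  · intro a
    exact isBalanced_atoms hL (T.finite_preimages a n j) (T.preimages_subset a n j) hδ hη
      (fun x hx y hy => H.separation hlen (Set.union_subset_union_left _ (hsub a) hx)
        (Set.union_subset_union_left _ (hsub a) hy))
      fun x y hx hy hxy => hq.exists_preimage_mem_Ioo hd hirr hK a hj hx hy hxy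
  · have hsub' := Set.iUnion_subset hsub
    refine isBalanced_atoms hL (Set.finite_iUnion fun a => T.finite_preimages a n j)
      (Set.iUnion_subset fun a => T.preimages_subset a n j) hδ hη
      (fun x hx y hy => H.separation hlen (Set.union_subset_union_left _ hsub' hx)
        (Set.union_subset_union_left _ hsub' hy)) fun x y hx hy hxy => ?_
    obtain ⟨a, -⟩ := T.exists_perm_eq_zero false
    obtain ⟨z, hz, hz'⟩ := hq.exists_preimage_mem_Ioo hd hirr hK a hj hx hy hxy
    exact ⟨z, Set.mem_iUnion.2 ⟨a, hz⟩, hz'⟩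

end

end IET

theorem proposition3 {A : Type*} [Fintype A] [DecidableEq A] {d : ℕ} (hd : 2 ≤ d)
    (T : IET A d) (hirr : T.IsIrreducible) (hkeane : T.Keane) :
    T.IsBoundedType ↔ T.HasBalancedPartitionLengths :=
  ⟨fun h => h.hasBalancedPartitionLengths hd hirr hkeane,
    fun h => h.isBoundedType hd hirr hkeane⟩
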